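/- Let $N\ge 3$ and $m\ge 1$ be integers and let $p>1$ be real. Set $\alpha_p:=\max\{0,\tfrac{p(N-2)-(N+2)}{2}\}$, and let $B^k\subset\mathbb R^k$ denote the open unit ball centred at the origin. The nodal sets of a function $f$ on $B^k$ are the connected components of $\{x\in B^k: f(x)\neq 0\}$. For each $\alpha>\alpha_p$ let $u_\alpha\in C^2(\overline{B^N})$ be the radial solution of $$-\Delta u=|x|^\alpha|u|^{p-1}u\ \text{ in } B^N,\qquad u=0\ \text{ on }\partial B^N,$$ with exactly $m$ nodal sets and $u_\alpha(0)>0$, and let $w\in C^2(\overline{B^2})$ be the radial solution of $$-\Delta w=|w|^{p-1}w\ \text{ in } B^2,\qquad w=0\ \text{ on }\partial B^2,$$ with exactly $m$ nodal sets and $w(0)>0$. Radial functions are identified with functions of $|x|\in[0,1]$. Then $u_\alpha$ and $w$ each have exactly $m$ zeros in $(0,1]$; denote them by $r_{1,\alpha}<\dots<r_{m,\alpha}=1$ and $t_1<\dots<t_m=1$, respectively, and set $$\mathcal M_{1,\alpha}:=\max_{0\le r\le r_{1,\alpha}}u_\alpha(r),\qquad \mathcal M_{i+1,\alpha}:=\max_{r_{i,\alpha}\le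 r\le r_{i+1,\alpha}}|u_\alpha(r)|\quad(1\le i\le m-1).$$ The following hold. (i) For each $i=1,\dots,m$, $\ \alpha(1-r_{i,\alpha})\to-2\log t_i$ as $\alpha\to\infty$. (ii) For every $0<R_0<1$, $\ \left(\tfrac{2}{\alpha+2}\right)^{2/(p-1)}u_\alpha(x)\to w(0)$ uniformly in $B(0,R_0)=\{x\in\mathbb R^N:|x|<R_0\}$ as $\alpha\to\infty$. (iii) There exist $\alpha_0>\alpha_p$ and constants $C_1,C_2>0$ such that $$C_1\left(\tfrac{\alpha+2}{2}\right)^{2/(p-1)}\le\mathcal M_{i,\alpha}\le C_2\left(\tfrac{\alpha+2}{2}\right)^{2/(p-1)}\qquad\text{for all } i=1,\dots,m\text{ and all }\alpha\ge\alpha_0.$$ -/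

import Mathlib

open Filter Topology Set

noncomputable section

/-- A function `U` of one variable on `[0,1]`, read as the radial function `x ↦ U |x|` on `ℝ^N`. -/
def radialFun (N : ℕ) (U : ℝ → ℝ) : EuclideanSpace ℝ (Fin N) → ℝ := fun x => U ‖x‖

/-- `f` has exactly `m` nodal sets (connected components of `{x ∈ B^N : f x ≠ 0}`) in the open
unit ball `B^N`. Since `Nat.card` of an infinite type is `0`, this is used with `m ≥ 1` only. -/
def HasNodalSets (N m : ℕ) (f : EuclideanSpace ℝ (Fin N) → ℝ) : Prop :=
  Nat.card (ConnectedComponents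
    {x : EuclideanSpace ℝ (Fin N) // x ∈ Metric.ball (0 : EuclideanSpace ℝ (Fin N)) 1 ∧ f x ≠ 0})
    = m

/-- `f` is a classical solution, of class `C²` up to the boundary of the unit ball `B^N`, of
`-Δ f = K(x) |f|^{p-1} f` in `B^N`, `f = 0` on `∂B^N`. -/
structure IsDirichletSolution (N : ℕ) (K : EuclideanSpace ℝ (Fin N) → ℝ) (p : ℝ)
    (f : EuclideanSpace ℝ (Fin N) → ℝ) : Prop where
  contDiffOn : ContDiffOn ℝ 2 f (Metric.closedBall 0 1)
  equation : ∀ x ∈ Metric.ball (0 : EuclideanSpace ℝ (Fin N)) 1,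
    -(Laplacian.laplacian f : EuclideanSpace ℝ (Fin N) → ℝ) x = K x * (|f x| ^ (p - 1) * f x)
  boundary : ∀ x ∈ Metric.sphere (0 : EuclideanSpace ℝ (Fin N)) 1, f x = 0

/-- `U` represents a radial solution, positive at the origin and with exactly `m` nodal sets, of
the Hénon problem `-Δ u = |x|^α |u|^{p-1} u` in `B^N`, `u = 0` on `∂B^N`. -/
structure IsHenonSolution (N : ℕ) (α p : ℝ) (m : ℕ) (U : ℝ → ℝ) : Prop where
  solution : IsDirichletSolution N (fun x => ‖x‖ ^ α) p (radialFun N U)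
  nodal : HasNodalSets N m (radialFun N U)
  pos_zero : 0 < U 0

/-- `W` represents a radial solution, positive at the origin and with exactly `m` nodal sets, of
the planar Lane-Emden problem `-Δ w = |w|^{p-1} w` in `B^2`, `w = 0` on `∂B^2`. -/
structure IsLaneEmdenSolution (p : ℝ) (m : ℕ) (W : ℝ → ℝ) : Prop where
  solution : IsDirichletSolution 2 (fun _ => 1) p (radialFun 2 W)
  nodal : HasNodalSets 2 m (radialFun 2 W)
  pos_zero : 0 < W 0

/-- The threshold `α_p = max {0, (p(N-2) - (N+2))/2}`. -/
def alphaThreshold (N : ℕ) (p : ℝ) : ℝ := max 0 ((p * ((N : ℝ) - 2) - ((N : ℝ) + 2)) / 2)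

/-- `z 1 < ⋯ < z m = 1` are precisely the zeros of `U` in `(0,1]`. -/
structure IsZeroEnumeration (m : ℕ) (U : ℝ → ℝ) (z : ℕ → ℝ) : Prop where
  strictMonoOn : StrictMonoOn z (Icc 1 m)
  image_eq : z '' Icc 1 m = {s : ℝ | s ∈ Ioc 0 1 ∧ U s = 0}
  last : z m = 1

/-- `M 1 = max {U s : 0 ≤ s ≤ z 1}` and `M (i+1) = max {|U s| : z i ≤ s ≤ z (i+1)}` for
`1 ≤ i ≤ m - 1`. -/
structure IsExtremalValues (m : ℕ) (U : ℝ → ℝ) (z M : ℕ → ℝ) : Prop where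
  first : IsGreatest (U '' Icc 0 (z 1)) (M 1)
  succ : ∀ i : ℕ, 1 ≤ i → i + 1 ≤ m →
    IsGreatest ((fun s => |U s|) '' Icc (z i) (z (i + 1))) (M (i + 1))

end

/-!
The substitution `r = (x / a)^θ`, `θ = 2 / (α + 2)`, removes the weight `|x|^α` from the radial Hénon
equation and turns it into the Lane-Emden equation `φ'' + (k / x) φ' + |φ|^{p-1} φ = 0` in the
fractional dimension `k + 1 = 2 + (N - 2) θ`. With `a = θ u(0)^{(p-1)/2}` and after division by `u(0)`
the new function satisfies `φ(0) = 1`, `φ'(0) = 0` and lives on `[0, a]`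
(`IsRadialHenon.isEmdenProfile`); the planar solution `w` is the case `N = 2`, `α = 0`. As `α → ∞` the
dimension tends to two, so everything reduces to continuous dependence of this singular initial value
problem on `k`.

The energy `φ'² / 2 + |φ|^{p+1} / (p+1)` decreases, which gives `|φ| ≤ 1` and `|φ'| ≤ 1`, and in the
comparison of two profiles (`IsEmdenProfile.dist_sq_le`) the singular term has a favourable sign, so
that an elementary Gronwall argument yields `C¹` convergence on the common interval. Zeros are simple,
and `IsEmdenProfile.tendsto_zeros` shows, one zero after another, that the zeros of the profiles
converge to those of the limit. Since the last zero is `a` itself, also `a` converges, without any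
continuation of solutions beyond the unit ball. That a solution with `m` nodal sets has exactly `m`
zeros is `HasNodalSets.ncard_zeros`.

Undoing the substitution, the convergence of `a` is that of the rescaled central values, the
convergence of the quotients of zeros is that of `r_i^{(α+2)/2}` to `t_i`, which after taking
logarithms is the asymptotics of `1 - r_i`. The uniform convergence on smaller balls holds because
`a |x|^{(α+2)/2} → 0` uniformly for `|x| < R₀`; the extremal values are at most `u(0)`, and not much
smaller because at a fixed point between two zeros of the limit profile the profiles stay away from
zero.
-/

/-! ### The power nonlinearity -/

/-- A continuous factor in front of `t` suffices for differentiability at the origin. -/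
lemma hasDerivAt_mul_self_zero {h : ℝ → ℝ} (hh : ContinuousAt h 0) :
    HasDerivAt (fun t => h t * t) (h 0) 0 := by
  rw [hasDerivAt_iff_tendsto_slope]
  refine (hh.tendsto.mono_left nhdsWithin_le_nhds).congr' ?_
  filter_upwards [self_mem_nhdsWithin] with t ht
  have ht' : t ≠ 0 := ht
  simp [slope_def_field, ht']

/-- The odd power `|t|^{p-1} t`, the nonlinearity of the Hénon and Lane-Emden equations. -/
noncomputable def oddPow (p t : ℝ) : ℝ := |t| ^ (p - 1) * t

lemma continuous_oddPow {p : ℝ} (hp : 1 < p) : Continuous (oddPow p) :=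
  (continuous_abs.rpow_const fun _ => Or.inr (by linarith)).mul continuous_id

lemma hasDerivAt_oddPow {p : ℝ} (hp : 1 < p) (t : ℝ) :
    HasDerivAt (oddPow p) (p * |t| ^ (p - 1)) t := by
  rcases eq_or_ne t 0 with rfl | ht
  · have hc : Continuous fun t : ℝ => |t| ^ (p - 1) :=
      continuous_abs.rpow_const fun _ => Or.inr (by linarith)
    have := hasDerivAt_mul_self_zero hc.continuousAt
    simp only [abs_zero, Real.zero_rpow (by linarith : p - 1 ≠ 0), mul_zero] at this ⊢
    exact this
  · have h1 := ((hasDerivAt_abs ht).rpow_const (p := p - 1) (Or.inl (abs_ne_zero.2 ht))).mul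
      (hasDerivAt_id t)
    refine h1.congr_deriv ?_
    have h2 : |t| ^ (p - 1) = |t| ^ (p - 1 - 1) * |t| := by
      rw [← Real.rpow_add_one (abs_ne_zero.2 ht)]; ring_nf
    have h3 : (SignType.sign t : ℝ) * t = |t| := sign_mul_self t
    simp only [id, mul_one]
    rw [h2]
    linear_combination (p - 1) * |t| ^ (p - 1 - 1) * h3

lemma abs_oddPow_le_abs {p t : ℝ} (hp : 1 < p) (ht : |t| ≤ 1) : |oddPow p t| ≤ |t| := by
  rw [oddPow, abs_mul, abs_of_nonneg (Real.rpow_nonneg (abs_nonneg t) _)]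
  exact mul_le_of_le_one_left (abs_nonneg t)
    (Real.rpow_le_one (abs_nonneg t) ht (by linarith))

lemma abs_oddPow_sub_le {p s t : ℝ} (hp : 1 < p) (hs : |s| ≤ 1) (ht : |t| ≤ 1) :
    |oddPow p s - oddPow p t| ≤ p * |s - t| := by
  have := Convex.norm_image_sub_le_of_norm_hasDerivWithin_le (f := oddPow p)
    (f' := fun t => p * |t| ^ (p - 1)) (C := p) (s := Icc (-1) 1) (x := t) (y := s)
    (fun x _ => (hasDerivAt_oddPow hp x).hasDerivWithinAt) ?_ (convex_Icc _ _)
    (abs_le.1 ht) (abs_le.1 hs)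
  · simpa using this
  · intro x hx
    rw [Real.norm_eq_abs, abs_of_nonneg (by positivity)]
    exact mul_le_of_le_one_right (by linarith)
      (Real.rpow_le_one (abs_nonneg x) (abs_le.2 hx) (by linarith))

/-! ### Normalised radial profiles in fractional dimension -/

/-- `φ`, with derivative `g`, is the radial profile on `[0, a]` normalised by `φ 0 = 1` of the
Lane-Emden equation in the (possibly fractional) dimension `k + 1`:
`φ'' + (k / x) φ' + |φ|^{p-1} φ = 0`. -/
structure IsEmdenProfile (k p a : ℝ) (φ g : ℝ → ℝ) : Prop where
  pos : 0 < a
  continuousOn : ContinuousOn φ (Icc 0 a)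
  continuousOn_deriv : ContinuousOn g (Icc 0 a)
  hasDerivAt : ∀ x ∈ Ioo 0 a, HasDerivAt φ (g x) x
  hasDerivAt_deriv : ∀ x ∈ Ioo 0 a, HasDerivAt g (-(k / x) * g x - oddPow p (φ x)) x
  zero : φ 0 = 1
  deriv_zero : g 0 = 0

/-- Integrating `(x^k g)' = -x^k h` from the origin: a bound on the source `h` bounds `g`
linearly. -/
lemma abs_le_mul_of_radial {k a B : ℝ} (hk : 1 ≤ k) {g h : ℝ → ℝ}
    (hc : ContinuousOn (fun x => x ^ k * g x) (Icc 0 a))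
    (hd : ∀ x ∈ Ioo 0 a, HasDerivAt g (-(k / x) * g x - h x) x)
    (hB : ∀ x ∈ Ioo 0 a, |h x| ≤ B) {x : ℝ} (hx : x ∈ Ioc 0 a) : |g x| ≤ B * x := by
  have hk0 : k ≠ 0 := by linarith
  have hB0 : 0 ≤ B := (abs_nonneg _).trans (hB (x / 2) ⟨by linarith [hx.1], by linarith [hx.1, hx.2]⟩)
  have hder : ∀ y ∈ Ioo 0 a, HasDerivAt (fun x => x ^ k * g x) (-(y ^ k * h y)) y := by
    intro y hy
    have := (Real.hasDerivAt_rpow_const (x := y) (p := k) (Or.inr hk)).mul (hd y hy)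
    refine this.congr_deriv ?_
    rw [Real.rpow_sub_one hy.1.ne']
    field_simp
    ring
  have hpow : ∀ y : ℝ, HasDerivAt (fun x => B * x ^ (k + 1)) (B * ((k + 1) * y ^ k)) y := by
    intro y
    have := (Real.hasDerivAt_rpow_const (x := y) (p := k + 1) (Or.inr (by linarith))).const_mul B
    simpa using this
  have hcp : ContinuousOn (fun x => B * x ^ (k + 1)) (Icc 0 a) :=
    fun y _ => (hpow y).continuousAt.continuousWithinAt
  have hest : ∀ y ∈ Ioo 0 a, |y ^ k * h y| ≤ B * ((k + 1) * y ^ k) := by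
    intro y hy
    have hyk : 0 ≤ y ^ k := Real.rpow_nonneg hy.1.le _
    rw [abs_mul, abs_of_nonneg hyk]
    have h1 := mul_le_mul_of_nonneg_left (hB y hy) hyk
    nlinarith [mul_nonneg (mul_nonneg hB0 (by linarith : (0:ℝ) ≤ k)) hyk]
  have h0 : (0 : ℝ) ∈ Icc 0 a := ⟨le_rfl, hx.1.le.trans hx.2⟩
  have hxm : x ∈ Icc 0 a := ⟨hx.1.le, hx.2⟩
  have hlow : MonotoneOn (fun x => x ^ k * g x + B * x ^ (k + 1)) (Icc 0 a) := by
    refine monotoneOn_of_hasDerivWithinAt_nonneg (convex_Icc _ _) (hc.add hcp)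
      (f' := fun y => -(y ^ k * h y) + B * ((k + 1) * y ^ k)) ?_ ?_
    · intro y hy
      rw [interior_Icc] at hy
      exact ((hder y hy).add (hpow y)).hasDerivWithinAt
    · intro y hy
      rw [interior_Icc] at hy
      linarith [(abs_le.1 (hest y hy)).2]
  have hupp : AntitoneOn (fun x => x ^ k * g x - B * x ^ (k + 1)) (Icc 0 a) := by
    refine antitoneOn_of_hasDerivWithinAt_nonpos (convex_Icc _ _) (hc.sub hcp)
      (f' := fun y => -(y ^ k * h y) - B * ((k + 1) * y ^ k)) ?_ ?_
    · intro y hy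
      rw [interior_Icc] at hy
      exact ((hder y hy).sub (hpow y)).hasDerivWithinAt
    · intro y hy
      rw [interior_Icc] at hy
      linarith [(abs_le.1 (hest y hy)).1]
  have h1 := hlow h0 hxm hx.1.le
  have h2 := hupp h0 hxm hx.1.le
  simp only [Real.zero_rpow hk0, Real.zero_rpow (by linarith : k + 1 ≠ 0), zero_mul, mul_zero,
    add_zero, sub_zero] at h1 h2
  have hxk : 0 < x ^ k := Real.rpow_pos_of_pos hx.1 _
  rw [Real.rpow_add_one hx.1.ne'] at h1 h2
  rw [abs_le]
  constructor
  · exact le_of_mul_le_mul_left (by linarith) hxk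
  · exact le_of_mul_le_mul_left (by linarith) hxk

namespace IsEmdenProfile

variable {k p a : ℝ} {φ g : ℝ → ℝ}

/-- The energy `g² / 2 + |φ|^{p+1} / (p+1)` is nonincreasing, hence at most its value
`1 / (p+1)` at the origin. -/
lemma energy_le (h : IsEmdenProfile k p a φ g) (hk : 1 ≤ k) (hp : 1 < p) {x : ℝ}
    (hx : x ∈ Icc 0 a) : (p + 1) * g x ^ 2 / 2 + |φ x| ^ (p + 1) ≤ 1 := by
  have hanti : AntitoneOn (fun x => (p + 1) * g x ^ 2 / 2 + |φ x| ^ (p + 1)) (Icc 0 a) := by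
    refine antitoneOn_of_hasDerivWithinAt_nonpos (convex_Icc _ _) ?_
      (f' := fun y => -((p + 1) * (k / y) * g y ^ 2)) ?_ ?_
    · refine ContinuousOn.add ?_ ?_
      · exact (continuousOn_const.mul (h.continuousOn_deriv.pow 2)).div_const _
      · exact h.continuousOn.abs.rpow_const fun _ _ => Or.inr (by linarith)
    · intro y hy
      rw [interior_Icc] at hy
      have h1 := (((h.hasDerivAt_deriv y hy).pow 2).const_mul (p + 1)).div_const 2
      have h2 := (hasDerivAt_abs_rpow (φ y) (p := p + 1) (by linarith)).comp y (h.hasDerivAt y hy)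
      refine (HasDerivAt.congr_deriv (h1.add h2) ?_).hasDerivWithinAt
      rw [oddPow, show p + 1 - 2 = p - 1 by ring]
      simp only [Nat.cast_ofNat, Nat.add_one_sub_one, pow_one]
      ring
    · intro y hy
      rw [interior_Icc] at hy
      have : 0 ≤ k / y := div_nonneg (by linarith) hy.1.le
      have : 0 ≤ (p + 1) * (k / y) * g y ^ 2 := by positivity
      linarith
  have := hanti ⟨le_rfl, h.pos.le⟩ hx hx.1
  simpa [h.zero, h.deriv_zero] using this

lemma abs_le_one (h : IsEmdenProfile k p a φ g) (hk : 1 ≤ k) (hp : 1 < p) {x : ℝ}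
    (hx : x ∈ Icc 0 a) : |φ x| ≤ 1 := by
  have h1 := h.energy_le hk hp hx
  have h2 : 0 ≤ (p + 1) * g x ^ 2 / 2 := by positivity
  by_contra! hc
  linarith [Real.one_lt_rpow hc (by linarith : 0 < p + 1)]

lemma abs_deriv_le_one (h : IsEmdenProfile k p a φ g) (hk : 1 ≤ k) (hp : 1 < p) {x : ℝ}
    (hx : x ∈ Icc 0 a) : |g x| ≤ 1 := by
  have h1 := h.energy_le hk hp hx
  have h2 : 0 ≤ |φ x| ^ (p + 1) := by positivity
  rw [← sq_le_one_iff_abs_le_one]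
  nlinarith [sq_nonneg (g x)]

lemma abs_oddPow_le_one (h : IsEmdenProfile k p a φ g) (hk : 1 ≤ k) (hp : 1 < p) {x : ℝ}
    (hx : x ∈ Icc 0 a) : |oddPow p (φ x)| ≤ 1 :=
  (abs_oddPow_le_abs hp (h.abs_le_one hk hp hx)).trans (h.abs_le_one hk hp hx)

lemma abs_deriv_le_self (h : IsEmdenProfile k p a φ g) (hk : 1 ≤ k) (hp : 1 < p) {x : ℝ}
    (hx : x ∈ Ioc 0 a) : |g x| ≤ x := by
  have := abs_le_mul_of_radial hk (g := g) (h := fun x => oddPow p (φ x)) (B := 1)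
    ((Real.continuous_rpow_const (by linarith)).continuousOn.mul h.continuousOn_deriv)
    h.hasDerivAt_deriv (fun y hy => h.abs_oddPow_le_one hk hp (Ioo_subset_Icc_self hy)) hx
  simpa using this

lemma abs_sub_one_le (h : IsEmdenProfile k p a φ g) (hk : 1 ≤ k) (hp : 1 < p) {x : ℝ}
    (hx : x ∈ Icc 0 a) : |φ x - 1| ≤ x := by
  rcases hx.1.eq_or_lt with rfl | hx0
  · simp [h.zero]
  obtain ⟨c, hc, hc'⟩ := exists_hasDerivAt_eq_slope φ g hx0
    (h.continuousOn.mono (Icc_subset_Icc_right hx.2))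
    (fun y hy => h.hasDerivAt y ⟨hy.1, hy.2.trans_le hx.2⟩)
  have h1 := h.abs_deriv_le_one hk hp (x := c) ⟨hc.1.le, hc.2.le.trans hx.2⟩
  rw [hc', sub_zero, abs_div, abs_of_pos hx0, div_le_one hx0, h.zero] at h1
  exact h1

/-- Zeros are simple: vanishing Cauchy data at `ρ` would propagate backwards to the origin,
because `e^{Cx} (φ² + g²)` is nondecreasing on `[x₀, ρ]` for a suitable `C`. -/
lemma deriv_ne_zero (h : IsEmdenProfile k p a φ g) (hk : 1 ≤ k) (hp : 1 < p) {ρ : ℝ}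
    (hρ : ρ ∈ Icc 0 a) (h0 : φ ρ = 0) : g ρ ≠ 0 := by
  intro hg
  have hρ0 : 0 < ρ := by
    rcases hρ.1.eq_or_lt with h1 | h1
    · rw [← h1, h.zero] at h0; norm_num at h0
    · exact h1
  have key : ∀ x₀ ∈ Ioc 0 ρ, φ x₀ = 0 := by
    intro x₀ hx₀
    set C : ℝ := 2 + 2 * k / x₀ with hC
    have hsub : Icc x₀ ρ ⊆ Icc 0 a := Icc_subset_Icc hx₀.1.le hρ.2
    have hmono : MonotoneOn (fun x => Real.exp (C * x) * (φ x ^ 2 + g x ^ 2)) (Icc x₀ ρ) := by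
      refine monotoneOn_of_hasDerivWithinAt_nonneg (convex_Icc _ _) ?_
        (f' := fun x => Real.exp (C * x) * (C * (φ x ^ 2 + g x ^ 2) +
          (2 * φ x * g x + 2 * g x * (-(k / x) * g x - oddPow p (φ x))))) ?_ ?_
      · exact (by fun_prop : Continuous fun x => Real.exp (C * x)).continuousOn.mul
          (((h.continuousOn.mono hsub).pow 2).add ((h.continuousOn_deriv.mono hsub).pow 2))
      · intro y hy
        rw [interior_Icc] at hy
        have hy' : y ∈ Ioo 0 a := ⟨hx₀.1.trans hy.1, hy.2.trans_le hρ.2⟩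
        have h1 : HasDerivAt (fun x => Real.exp (C * x)) (Real.exp (C * y) * C) y := by
          simpa using ((hasDerivAt_id y).const_mul C).exp
        have h2 := h1.mul (((h.hasDerivAt y hy').pow 2).add ((h.hasDerivAt_deriv y hy').pow 2))
        refine (HasDerivAt.congr_deriv h2 ?_).hasDerivWithinAt
        simp only [Pi.add_apply, Pi.pow_apply, Nat.cast_ofNat, Nat.add_one_sub_one, pow_one]
        ring
      · intro y hy
        rw [interior_Icc] at hy
        have hy' : y ∈ Icc 0 a := hsub (Ioo_subset_Icc_self hy)
        refine mul_nonneg (Real.exp_pos _).le ?_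
        have hf := abs_oddPow_le_abs hp (h.abs_le_one hk hp hy')
        have h1 : k / y ≤ k / x₀ := div_le_div_of_nonneg_left (by linarith) hx₀.1 hy.1.le
        have h2 : |g y * oddPow p (φ y)| ≤ |g y| * |φ y| := by
          rw [abs_mul]; exact mul_le_mul_of_nonneg_left hf (abs_nonneg _)
        have h3 : |g y * φ y| = |g y| * |φ y| := abs_mul _ _
        have h4 : 2 * (|g y| * |φ y|) ≤ g y ^ 2 + φ y ^ 2 := by
          have := two_mul_le_add_sq (|g y|) (|φ y|)
          rw [sq_abs, sq_abs] at this
          linarith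
        have h5 := mul_le_mul_of_nonneg_right h1 (sq_nonneg (g y))
        have h6 : 0 ≤ k / x₀ * φ y ^ 2 :=
          mul_nonneg (div_nonneg (by linarith) hx₀.1.le) (sq_nonneg _)
        have h7 : C = 2 + 2 * (k / x₀) := by rw [hC]; ring
        rw [h7]
        nlinarith [(abs_le.1 h2).2, neg_abs_le (g y * φ y)]
    have h1 := hmono ⟨le_rfl, hx₀.2⟩ ⟨hx₀.2, le_rfl⟩ hx₀.2
    simp only [h0, hg] at h1
    have h2 : φ x₀ ^ 2 + g x₀ ^ 2 ≤ 0 := by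
      have := Real.exp_pos (C * x₀)
      by_contra! hc
      have := mul_pos this hc
      norm_num at h1
      linarith
    nlinarith [sq_nonneg (φ x₀), sq_nonneg (g x₀)]
  have hcl : (0 : ℝ) ∈ closure (Ioc 0 ρ) := by
    rw [closure_Ioc hρ0.ne]; exact ⟨le_rfl, hρ0.le⟩
  have hcw : ContinuousWithinAt φ (Ioc 0 ρ) 0 :=
    (h.continuousOn 0 ⟨le_rfl, h.pos.le⟩).mono fun y hy => ⟨hy.1.le, hy.2.trans hρ.2⟩
  have : φ 0 ∈ closure ({0} : Set ℝ) := hcw.mem_closure hcl (fun y hy => by simp [key y hy])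
  simp [h.zero] at this

/-- Rolle's theorem in the form used for zeros. -/
lemma exists_deriv_eq_zero (h : IsEmdenProfile k p a φ g) {x y : ℝ} (hx : 0 ≤ x) (hxy : x < y)
    (hy : y ≤ a) (h1 : φ x = 0) (h2 : φ y = 0) : ∃ c ∈ Ioo x y, g c = 0 :=
  exists_hasDerivAt_eq_zero hxy (h.continuousOn.mono (Icc_subset_Icc hx hy)) (h1.trans h2.symm)
    fun _ hz => h.hasDerivAt _ ⟨hx.trans_lt hz.1, hz.2.trans_le hy⟩

/-- There are finitely many zeros: at an accumulation point both `φ` and, by Rolle's theorem,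
`g` would vanish. -/
lemma finite_zeros (h : IsEmdenProfile k p a φ g) (hk : 1 ≤ k) (hp : 1 < p) :
    {x | x ∈ Icc 0 a ∧ φ x = 0}.Finite := by
  by_contra hinf
  obtain ⟨ρ, hρ, hacc⟩ := Set.Infinite.exists_accPt_of_subset_isCompact
    (s := {x | x ∈ Icc 0 a ∧ φ x = 0}) hinf isCompact_Icc fun x hx => hx.1
  have hclosed : IsClosed {x | x ∈ Icc 0 a ∧ φ x = 0} := by
    have := h.continuousOn.preimage_isClosed_of_isClosed isClosed_Icc (isClosed_singleton (x := 0))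
    exact this
  have hρ0 : φ ρ = 0 := (hclosed.closure_subset (mem_closure_iff_clusterPt.2 hacc.clusterPt)).2
  have hg := h.deriv_ne_zero hk hp hρ hρ0
  have hev : ∀ᶠ y in 𝓝[Icc 0 a] ρ, g y ≠ 0 := (h.continuousOn_deriv ρ hρ).eventually_ne hg
  rw [eventually_nhdsWithin_iff] at hev
  obtain ⟨ε, hε, hball⟩ := Metric.eventually_nhds_iff_ball.1 hev
  obtain ⟨z, ⟨hz1, hz2⟩, hzne⟩ := accPt_iff_nhds.1 hacc _ (Metric.ball_mem_nhds ρ hε)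
  rw [Metric.mem_ball, Real.dist_eq, abs_lt] at hz1
  have hfin : ∀ x y : ℝ, x < y → 0 ≤ x → y ≤ a → ρ - ε < x → y < ρ + ε → φ x = 0 → φ y = 0 →
      False := by
    intro x y hxy hx hy hx' hy' h1 h2
    obtain ⟨c, hc, hc0⟩ := h.exists_deriv_eq_zero hx hxy hy h1 h2
    refine hball c ?_ ⟨hx.trans hc.1.le, hc.2.le.trans hy⟩ hc0
    rw [Metric.mem_ball, Real.dist_eq, abs_lt]
    constructor <;> linarith [hc.1, hc.2]
  rcases lt_or_gt_of_ne hzne with hlt | hlt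
  · exact hfin z ρ hlt hz2.1.1 hρ.2 (by linarith) (by linarith) hz2.2 hρ0
  · exact hfin ρ z hlt hρ.1 hz2.1.2 (by linarith) (by linarith) hρ0 hz2.2

/-- Continuous dependence on the dimension: Gronwall's inequality for
`E = (φ - φ₀)² + (g - g₀)²`, in which the singular term `-(2 / x) (g - g₀)²` has the good sign,
so that `e^{-(p+2)x} E - (k-1)² x` is nonincreasing. -/
lemma dist_sq_le {a₀ : ℝ} {φ₀ g₀ : ℝ → ℝ} (h : IsEmdenProfile k p a φ g) (hk : 1 ≤ k) (hp : 1 < p)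
    (h₀ : IsEmdenProfile 1 p a₀ φ₀ g₀) {x : ℝ} (hx0 : 0 ≤ x) (hxa : x ≤ a) (hxa₀ : x ≤ a₀) :
    (φ x - φ₀ x) ^ 2 + (g x - g₀ x) ^ 2 ≤ Real.exp ((p + 2) * x) * ((k - 1) ^ 2 * x) := by
  have hs : Icc 0 x ⊆ Icc 0 a := Icc_subset_Icc_right hxa
  have hs₀ : Icc 0 x ⊆ Icc 0 a₀ := Icc_subset_Icc_right hxa₀
  set K := p + 2 with hK
  have hanti : AntitoneOn (fun y => Real.exp (-K * y) * ((φ y - φ₀ y) ^ 2 + (g y - g₀ y) ^ 2)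
      - (k - 1) ^ 2 * y) (Icc 0 x) := by
    refine antitoneOn_of_hasDerivWithinAt_nonpos (convex_Icc _ _) ?_
      (f' := fun y => Real.exp (-K * y) * (-K * ((φ y - φ₀ y) ^ 2 + (g y - g₀ y) ^ 2) +
        (2 * (φ y - φ₀ y) * (g y - g₀ y) + 2 * (g y - g₀ y) *
          ((-(k / y) * g y - oddPow p (φ y)) - (-(1 / y) * g₀ y - oddPow p (φ₀ y)))))
        - (k - 1) ^ 2) ?_ ?_
    · refine ContinuousOn.sub ?_ (by fun_prop)
      exact (by fun_prop : Continuous fun x => Real.exp (-K * x)).continuousOn.mul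
          ((((h.continuousOn.mono hs).sub (h₀.continuousOn.mono hs₀)).pow 2).add
          (((h.continuousOn_deriv.mono hs).sub (h₀.continuousOn_deriv.mono hs₀)).pow 2))
    · intro y hy
      rw [interior_Icc] at hy
      have hya : y ∈ Ioo 0 a := ⟨hy.1, hy.2.trans_le hxa⟩
      have hya₀ : y ∈ Ioo 0 a₀ := ⟨hy.1, hy.2.trans_le hxa₀⟩
      have h1 : HasDerivAt (fun x => Real.exp (-K * x)) (Real.exp (-K * y) * -K) y := by
        simpa using ((hasDerivAt_id y).const_mul (-K)).exp
      have h2 := (h1.mul ((((h.hasDerivAt y hya).sub (h₀.hasDerivAt y hya₀)).pow 2).add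
        (((h.hasDerivAt_deriv y hya).sub (h₀.hasDerivAt_deriv y hya₀)).pow 2))).sub
        ((hasDerivAt_id y).const_mul ((k - 1) ^ 2))
      refine (HasDerivAt.congr_deriv h2 ?_).hasDerivWithinAt
      simp only [Pi.add_apply, Pi.pow_apply, Pi.sub_apply, Nat.cast_ofNat, Nat.add_one_sub_one,
        pow_one]
      ring
    · intro y hy
      rw [interior_Icc] at hy
      have hya : y ∈ Icc 0 a := ⟨hy.1.le, hy.2.le.trans hxa⟩
      have hya₀ : y ∈ Icc 0 a₀ := ⟨hy.1.le, hy.2.le.trans hxa₀⟩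
      have hL := abs_oddPow_sub_le hp (h.abs_le_one hk hp hya) (h₀.abs_le_one le_rfl hp hya₀)
      have hg : |g y / y| ≤ 1 := by
        rw [abs_div, abs_of_pos hy.1, div_le_one hy.1]
        exact h.abs_deriv_le_self hk hp ⟨hy.1, hya.2⟩
      set d := φ y - φ₀ y
      set e := g y - g₀ y with he
      set F := oddPow p (φ y) - oddPow p (φ₀ y)
      set q := g y / y with hq
      have hsing : (-(k / y) * g y - oddPow p (φ y)) - (-(1 / y) * g₀ y - oddPow p (φ₀ y))
          = -(e / y) - (k - 1) * q - F := by
        simp only [F, he, hq]; ring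
      have hexp : Real.exp (-K * y) ≤ 1 := by
        rw [Real.exp_le_one_iff]; nlinarith [hy.1]
      have hed : 0 ≤ e * (e / y) := by
        rw [← mul_div_assoc]; exact div_nonneg (mul_self_nonneg e) hy.1.le
      have hF : |e * F| ≤ p * (|e| * |d|) := by
        rw [abs_mul]; nlinarith [mul_le_mul_of_nonneg_left hL (abs_nonneg e)]
      have hde : |e| * |d| ≤ (d ^ 2 + e ^ 2) / 2 := by
        have := two_mul_le_add_sq (|e|) (|d|)
        rw [sq_abs, sq_abs] at this
        linarith
      have hde' : d * e ≤ (d ^ 2 + e ^ 2) / 2 := by nlinarith [sq_nonneg (d - e)]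
      have hF' : -(e * F) ≤ p * ((d ^ 2 + e ^ 2) / 2) := by
        have := mul_le_mul_of_nonneg_left hde (by linarith : (0 : ℝ) ≤ p)
        linarith [(abs_le.1 hF).1]
      have hq1 : q ^ 2 ≤ 1 := (sq_le_one_iff_abs_le_one q).2 hg
      have heq : -(2 * e * ((k - 1) * q)) ≤ e ^ 2 + (k - 1) ^ 2 := by
        nlinarith [sq_nonneg (e + (k - 1) * q), mul_le_mul_of_nonneg_left hq1 (sq_nonneg (k - 1))]
      rw [hsing]
      have hmain : -K * (d ^ 2 + e ^ 2) + (2 * d * e + 2 * e * (-(e / y) - (k - 1) * q - F))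
          ≤ (k - 1) ^ 2 := by
        rw [hK]; nlinarith [sq_nonneg d]
      have := mul_le_mul_of_nonneg_left hmain (Real.exp_pos (-K * y)).le
      nlinarith [mul_le_mul_of_nonneg_right hexp (sq_nonneg (k - 1))]
  have h1 := hanti ⟨le_rfl, hx0⟩ ⟨hx0, le_rfl⟩ hx0
  simp only [h.zero, h₀.zero, h.deriv_zero, h₀.deriv_zero] at h1
  norm_num at h1
  have h2 : (φ x - φ₀ x) ^ 2 + (g x - g₀ x) ^ 2 = Real.exp (K * x) *
      (Real.exp (-(K * x)) * ((φ x - φ₀ x) ^ 2 + (g x - g₀ x) ^ 2)) := by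
    rw [← mul_assoc, ← Real.exp_add]; simp
  rw [h2]
  exact mul_le_mul_of_nonneg_left h1 (Real.exp_pos _).le

end IsEmdenProfile

/-! ### Convergence of profiles and of their zeros -/

section Convergence

variable {ι : Type*} {l : Filter ι} {p a₀ : ℝ} {φ₀ g₀ : ℝ → ℝ} {k a : ι → ℝ} {φ g : ι → ℝ → ℝ}

/-- Profiles and their derivatives converge uniformly on the common interval of definition when
the dimension tends to two. -/
lemma IsEmdenProfile.eventually_close (hp : 1 < p) (h₀ : IsEmdenProfile 1 p a₀ φ₀ g₀)
    (h : ∀ᶠ j in l, 1 ≤ k j ∧ IsEmdenProfile (k j) p (a j) (φ j) (g j)) (hk : Tendsto k l (𝓝 1))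
    {η : ℝ} (hη : 0 < η) :
    ∀ᶠ j in l, ∀ x, 0 ≤ x → x ≤ a j → x ≤ a₀ → |φ j x - φ₀ x| < η ∧ |g j x - g₀ x| < η := by
  have hlim : Tendsto (fun j => Real.exp ((p + 2) * a₀) * ((k j - 1) ^ 2 * a₀)) l (𝓝 0) := by
    have := (((hk.sub_const 1).pow 2).mul_const a₀).const_mul (Real.exp ((p + 2) * a₀))
    simpa using this
  filter_upwards [h, hlim.eventually_lt_const (pow_pos hη 2)] with j hj hj' x hx0 hxa hxa₀
  have h1 := hj.2.dist_sq_le hj.1 hp h₀ hx0 hxa hxa₀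
  have h2 : Real.exp ((p + 2) * x) * ((k j - 1) ^ 2 * x) ≤
      Real.exp ((p + 2) * a₀) * ((k j - 1) ^ 2 * a₀) := by
    gcongr
  constructor <;> refine abs_lt_of_sq_lt_sq ?_ hη.le
  · nlinarith [sq_nonneg (g j x - g₀ x)]
  · nlinarith [sq_nonneg (φ j x - φ₀ x)]

/-- A profile has no zero in `[0, 1)`. -/
lemma IsEmdenProfile.one_le_of_eq_zero {k a x : ℝ} {φ g : ℝ → ℝ} (h : IsEmdenProfile k p a φ g)
    (hk : 1 ≤ k) (hp : 1 < p) (hx : x ∈ Icc 0 a) (h0 : φ x = 0) : 1 ≤ x := by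
  simpa [h0] using h.abs_sub_one_le hk hp hx

/-- The zero following one that converges to `σ₀` stays away from `σ₀`: otherwise Rolle's theorem
would give `g₀ σ₀ = 0`. -/
lemma IsEmdenProfile.eventually_zero_separated (hp : 1 < p) (h₀ : IsEmdenProfile 1 p a₀ φ₀ g₀)
    (h : ∀ᶠ j in l, 1 ≤ k j ∧ IsEmdenProfile (k j) p (a j) (φ j) (g j)) (hk : Tendsto k l (𝓝 1))
    {σ τ : ι → ℝ} {σ₀ : ℝ} (hσ : Tendsto σ l (𝓝 σ₀)) (hσ₀ : 0 < σ₀) (hσa : σ₀ < a₀)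
    (hz₀ : φ₀ σ₀ = 0) (hz : ∀ᶠ j in l, 0 ≤ σ j ∧ σ j < τ j ∧ τ j ≤ a j ∧ φ j (σ j) = 0 ∧
      φ j (τ j) = 0) :
    ∃ η > 0, ∀ᶠ j in l, σ₀ + η ≤ τ j := by
  have hmem : σ₀ ∈ Icc 0 a₀ := ⟨hσ₀.le, hσa.le⟩
  have hg := h₀.deriv_ne_zero le_rfl hp hmem hz₀
  have hev : ∀ᶠ y in 𝓝[Icc 0 a₀] σ₀, |g₀ σ₀| / 2 < |g₀ y| :=
    (h₀.continuousOn_deriv σ₀ hmem).abs.eventually_const_lt (half_lt_self (abs_pos.2 hg))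
  rw [eventually_nhdsWithin_iff] at hev
  obtain ⟨ε, hε, hball⟩ := Metric.eventually_nhds_iff_ball.1 hev
  refine ⟨min ε (a₀ - σ₀), lt_min hε (by linarith), ?_⟩
  filter_upwards [h, hz, hσ.eventually_const_lt (by linarith : σ₀ - ε < σ₀),
    eventually_close hp h₀ h hk (half_pos (abs_pos.2 hg))] with j hj hzj hσj hclose
  obtain ⟨hz1, hz2, hz3, hz4, hz5⟩ := hzj
  by_contra! hc
  have hc1 := hc.trans_le (add_le_add_right (min_le_left _ _) σ₀)
  have hc2 := hc.trans_le (add_le_add_right (min_le_right _ _) σ₀)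
  obtain ⟨c, hc, hc0⟩ := hj.2.exists_deriv_eq_zero hz1 hz2 hz3 hz4 hz5
  have hcpos : 0 ≤ c := hz1.trans hc.1.le
  have h1 := hball c (by
    rw [Metric.mem_ball, Real.dist_eq, abs_lt]
    constructor <;> linarith [hc.1, hc.2]) ⟨hcpos, by linarith [hc.2]⟩
  have h2 := (hclose c hcpos (hc.2.le.trans hz3) (by linarith [hc.2])).2
  rw [hc0, zero_sub, abs_neg] at h2
  linarith

/-- Just after a zero `τ₀` of the limit profile the approximating profiles, where defined, have the
sign of `g₀ τ₀`. Their second derivatives are bounded away from the origin, so this needs no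
information on the limit profile beyond `τ₀`, which may be the end of its interval. -/
lemma IsEmdenProfile.eventually_sign_after_zero (hp : 1 < p) (h₀ : IsEmdenProfile 1 p a₀ φ₀ g₀)
    (h : ∀ᶠ j in l, 1 ≤ k j ∧ IsEmdenProfile (k j) p (a j) (φ j) (g j)) (hk : Tendsto k l (𝓝 1))
    {τ₀ : ℝ} (hτ₀ : 0 < τ₀) (hτa : τ₀ ≤ a₀) (hz₀ : φ₀ τ₀ = 0) {δ : ℝ} (hδ : 0 < δ) :
    ∃ y, τ₀ < y ∧ y ≤ τ₀ + δ ∧ ∀ᶠ j in l, y < a j → 0 < g₀ τ₀ * φ j y := by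
  have hs := h₀.deriv_ne_zero le_rfl hp ⟨hτ₀.le, hτa⟩ hz₀
  set s := g₀ τ₀
  have hs' : 0 < |s| := abs_pos.2 hs
  set C : ℝ := 2 / τ₀ + 1 with hC
  have hC0 : 0 < C := by positivity
  set d := min δ (|s| / (4 * C)) with hd
  have hd0 : 0 < d := lt_min hδ (by positivity)
  have hdC : C * d ≤ |s| / 4 := by
    have := mul_le_mul_of_nonneg_left (min_le_right δ (|s| / (4 * C))) hC0.le
    rw [← hd] at this
    refine this.trans_eq ?_
    field_simp
  refine ⟨τ₀ + d, by linarith, by linarith [min_le_left δ (|s| / (4 * C))], ?_⟩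
  have hη : 0 < min (|s| / 4) (|s| * d / 4) := lt_min (by positivity) (by positivity)
  filter_upwards [h, hk.eventually_le_const (by norm_num : (1 : ℝ) < 2),
    eventually_close hp h₀ h hk hη] with j hj hkj hclose hya
  obtain ⟨h1, h2⟩ := hclose τ₀ hτ₀.le (by linarith) hτa
  rw [hz₀, sub_zero] at h1
  have h1 := h1.trans_le (min_le_right _ _)
  have h2 := h2.trans_le (min_le_left _ _)
  have hderiv : ∀ x ∈ Ioo τ₀ (τ₀ + d), |g j x - g j τ₀| ≤ C * d := by
    intro x hx
    obtain ⟨c, hc, hc'⟩ := exists_hasDerivAt_eq_slope (g j) _ hx.1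
      (hj.2.continuousOn_deriv.mono (Icc_subset_Icc hτ₀.le (by linarith [hx.2])))
      (fun y hy => hj.2.hasDerivAt_deriv y ⟨hτ₀.trans hy.1, by linarith [hy.2, hx.2]⟩)
    have hcm : c ∈ Icc 0 (a j) := ⟨by linarith [hc.1], by linarith [hc.2, hx.2]⟩
    have hc0 : 0 < c := hτ₀.trans hc.1
    have hb : |(-(k j / c) * g j c - oddPow p (φ j c))| ≤ C := by
      refine (abs_sub _ _).trans (add_le_add ?_ (hj.2.abs_oddPow_le_one hj.1 hp hcm))
      rw [abs_mul, abs_neg, abs_of_nonneg (div_nonneg (by linarith [hj.1]) hc0.le)]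
      calc k j / c * |g j c| ≤ k j / c * 1 := mul_le_mul_of_nonneg_left
            (hj.2.abs_deriv_le_one hj.1 hp hcm) (div_nonneg (by linarith [hj.1]) hc0.le)
        _ ≤ 2 / τ₀ := by
            rw [mul_one]
            exact div_le_div₀ (by norm_num) hkj hτ₀ hc.1.le
    have hx0 : 0 < x - τ₀ := by linarith [hx.1]
    rw [hc', abs_div, abs_of_pos hx0, div_le_iff₀ hx0] at hb
    exact hb.trans (mul_le_mul_of_nonneg_left (by linarith [hx.2]) hC0.le)
  obtain ⟨c, hc, hc'⟩ := exists_hasDerivAt_eq_slope (φ j) (g j) (by linarith : τ₀ < τ₀ + d)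
    (hj.2.continuousOn.mono (Icc_subset_Icc hτ₀.le (by linarith)))
    (fun y hy => hj.2.hasDerivAt y ⟨hτ₀.trans hy.1, by linarith [hy.2]⟩)
  rw [add_sub_cancel_left, eq_div_iff hd0.ne'] at hc'
  have h3 := hderiv c hc
  have h4 : |s * (g j c - s)| ≤ s ^ 2 / 2 := by
    rw [abs_mul, ← sq_abs s]
    have : |g j c - s| ≤ |s| / 2 := by
      have := abs_add_le (g j c - g j τ₀) (g j τ₀ - s)
      rw [sub_add_sub_cancel] at this
      linarith
    nlinarith
  have h5 : |s * φ j τ₀| ≤ s ^ 2 * d / 4 := by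
    rw [abs_mul, ← sq_abs s]
    nlinarith
  have h6 : s * φ j (τ₀ + d) = s * φ j τ₀ + (s ^ 2 + s * (g j c - s)) * d := by
    linear_combination -s * hc'
  have h7 := mul_le_mul_of_nonneg_right (abs_le.1 h4).1 hd0.le
  have h8 : 0 < s ^ 2 * d := by positivity
  rw [h6]
  nlinarith [(abs_le.1 h5).1]

/-- Just before a zero a profile has the sign opposite to that of its derivative at the zero. -/
lemma IsEmdenProfile.exists_sign_before_zero (hp : 1 < p) (h₀ : IsEmdenProfile 1 p a₀ φ₀ g₀)
    {σ₀ τ₀ : ℝ} (hσ₀ : 0 ≤ σ₀) (hστ : σ₀ < τ₀) (hτa : τ₀ ≤ a₀) (hz₀ : φ₀ τ₀ = 0) :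
    ∃ q ∈ Ioo σ₀ τ₀, g₀ τ₀ * φ₀ q < 0 := by
  have hmem : τ₀ ∈ Icc 0 a₀ := ⟨hσ₀.trans hστ.le, hτa⟩
  have hs := h₀.deriv_ne_zero le_rfl hp hmem hz₀
  have hev : ∀ᶠ y in 𝓝[Icc 0 a₀] τ₀, 0 < g₀ τ₀ * g₀ y :=
    ((h₀.continuousOn_deriv τ₀ hmem).const_mul (g₀ τ₀)).eventually_const_lt
      (mul_self_pos.2 hs)
  rw [eventually_nhdsWithin_iff] at hev
  obtain ⟨ε, hε, hball⟩ := Metric.eventually_nhds_iff_ball.1 hev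
  set q := max ((σ₀ + τ₀) / 2) (τ₀ - ε / 2)
  have hq1 : (σ₀ + τ₀) / 2 ≤ q := le_max_left _ _
  have hq2 : τ₀ - ε / 2 ≤ q := le_max_right _ _
  have hq3 : q < τ₀ := max_lt (by linarith) (by linarith)
  refine ⟨q, ⟨by linarith, hq3⟩, ?_⟩
  obtain ⟨c, hc, hc'⟩ := exists_hasDerivAt_eq_slope φ₀ g₀ hq3
    (h₀.continuousOn.mono (Icc_subset_Icc (by linarith) hτa))
    (fun y hy => h₀.hasDerivAt y ⟨by linarith [hy.1], by linarith [hy.2]⟩)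
  have hpos := hball c (by
    rw [Metric.mem_ball, Real.dist_eq, abs_lt]
    constructor <;> linarith [hc.1, hc.2]) ⟨by linarith [hc.1], by linarith [hc.2]⟩
  rw [hz₀, zero_sub, eq_div_iff (by linarith)] at hc'
  have : g₀ τ₀ * φ₀ q = -(g₀ τ₀ * g₀ c * (τ₀ - q)) := by
    linear_combination g₀ τ₀ * hc'
  rw [this]
  have := mul_pos hpos (by linarith : 0 < τ₀ - q)
  linarith

/-- Convergence passes from one zero to the next. -/
lemma IsEmdenProfile.tendsto_next_zero (hp : 1 < p) (h₀ : IsEmdenProfile 1 p a₀ φ₀ g₀)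
    (h : ∀ᶠ j in l, 1 ≤ k j ∧ IsEmdenProfile (k j) p (a j) (φ j) (g j)) (hk : Tendsto k l (𝓝 1))
    {σ τ : ι → ℝ} {σ₀ τ₀ : ℝ} (hσ : Tendsto σ l (𝓝 σ₀)) (hσ₀ : 0 ≤ σ₀) (hστ : σ₀ < τ₀)
    (hτa : τ₀ ≤ a₀) (hz₀ : φ₀ τ₀ = 0) (hne₀ : ∀ x ∈ Ioo σ₀ τ₀, φ₀ x ≠ 0)
    (hz : ∀ᶠ j in l, 0 ≤ σ j ∧ τ j ≤ a j ∧ φ j (τ j) = 0 ∧ ∀ x ∈ Ioo (σ j) (τ j), φ j x ≠ 0)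
    (hsep : ∃ η > 0, ∀ᶠ j in l, σ₀ + η ≤ τ j) :
    Tendsto τ l (𝓝 τ₀) := by
  obtain ⟨η, hη, hsep⟩ := hsep
  have hlow : ∀ δ > 0, ∀ᶠ j in l, τ₀ - δ < τ j := by
    intro δ hδ
    have hsub : Icc (σ₀ + η) (τ₀ - δ) ⊆ Icc 0 a₀ := Icc_subset_Icc (by linarith) (by linarith)
    obtain ⟨c, hc, hcK⟩ := isCompact_Icc.exists_forall_le' (h₀.continuousOn.mono hsub).abs
      (a := 0) (fun x hx => abs_pos.2 (hne₀ x ⟨by linarith [hx.1], by linarith [hx.2]⟩))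
    filter_upwards [hsep, hz, eventually_close hp h₀ h hk hc] with j hsj hzj hclose
    by_contra! hcon
    have h1 := (hclose (τ j) (by linarith) hzj.2.1 (by linarith)).1
    rw [hzj.2.2.1, zero_sub, abs_neg] at h1
    exact absurd (hcK (τ j) ⟨hsj, hcon⟩) (not_le.2 h1)
  have hupp : ∀ δ > 0, ∀ᶠ j in l, τ j ≤ τ₀ + δ := by
    intro δ hδ
    obtain ⟨y, hy1, hy2, hy⟩ := eventually_sign_after_zero hp h₀ h hk (hσ₀.trans_lt hστ) hτa hz₀ hδ
    obtain ⟨q, hq, hqs⟩ := h₀.exists_sign_before_zero hp hσ₀ hστ hτa hz₀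
    have hs : 0 < |g₀ τ₀| := abs_pos.2 fun h0 => by simp [h0] at hqs
    have hφq : 0 < |φ₀ q| := abs_pos.2 fun h0 => by simp [h0] at hqs
    filter_upwards [h, hz, hy, hσ.eventually_lt_const hq.1, eventually_close hp h₀ h hk hφq]
      with j hj hzj hyj hσj hclose
    by_contra! hcon
    have hya : y < a j := by linarith [hzj.2.1]
    have hpos := hyj hya
    have h1 := (hclose q (hσ₀.trans hq.1.le) (by linarith [hq.2]) (by linarith [hq.2])).1
    have hneg : g₀ τ₀ * φ j q < 0 := by
      have h2 : |g₀ τ₀ * (φ j q - φ₀ q)| < |g₀ τ₀ * φ₀ q| := by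
        rw [abs_mul, abs_mul]; exact mul_lt_mul_of_pos_left h1 hs
      rw [abs_of_neg hqs] at h2
      have := (abs_lt.1 h2).2
      rw [mul_sub] at this
      linarith
    have hqy : q ≤ y := by linarith [hq.2]
    obtain ⟨c, hc, hc0⟩ := intermediate_value_Icc hqy
      (continuousOn_const.mul (hj.2.continuousOn.mono
        (Icc_subset_Icc (hσ₀.trans hq.1.le) hya.le))) (show (0 : ℝ) ∈ Icc (g₀ τ₀ * φ j q)
          (g₀ τ₀ * φ j y) from ⟨hneg.le, hpos.le⟩)
    have hcz : φ j c = 0 := (mul_eq_zero.1 hc0).resolve_left (abs_pos.1 hs)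
    exact hzj.2.2.2 c ⟨hσj.trans_le hc.1, by linarith [hc.2]⟩ hcz
  rw [Metric.tendsto_nhds]
  intro ε hε
  filter_upwards [hlow ε hε, hupp (ε / 2) (half_pos hε)] with j h1 h2
  rw [Real.dist_eq, abs_lt]
  constructor <;> linarith

/-- `ρ 1 < ⋯ < ρ m` are the zeros of `φ` in `(0, a]`. -/
structure EnumeratesZeros (m : ℕ) (a : ℝ) (φ : ℝ → ℝ) (ρ : ℕ → ℝ) : Prop where
  strictMonoOn : StrictMonoOn ρ (Icc 1 m)
  image_eq : ρ '' Icc 1 m = {x | x ∈ Ioc 0 a ∧ φ x = 0}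

namespace EnumeratesZeros

variable {m : ℕ} {a : ℝ} {φ : ℝ → ℝ} {ρ : ℕ → ℝ}

lemma mem (h : EnumeratesZeros m a φ ρ) {i : ℕ} (hi : i ∈ Icc 1 m) : ρ i ∈ Ioc 0 a ∧ φ (ρ i) = 0 := by
  have : ρ i ∈ ρ '' Icc 1 m := ⟨i, hi, rfl⟩
  rwa [h.image_eq] at this

lemma exists_of_zero (h : EnumeratesZeros m a φ ρ) {x : ℝ} (hx : x ∈ Ioc 0 a) (h0 : φ x = 0) :
    ∃ i ∈ Icc 1 m, ρ i = x := by
  have : x ∈ ρ '' Icc 1 m := by rw [h.image_eq]; exact ⟨hx, h0⟩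
  exact this

lemma ne_zero_before (h : EnumeratesZeros m a φ ρ) (hm : 1 ≤ m) {x : ℝ} (hx : x ∈ Ioo 0 (ρ 1)) :
    φ x ≠ 0 := by
  intro h0
  have h1 := (h.mem ⟨le_rfl, hm⟩).1.2
  obtain ⟨i, hi, rfl⟩ := h.exists_of_zero ⟨hx.1, hx.2.le.trans h1⟩ h0
  exact absurd (h.strictMonoOn.monotoneOn ⟨le_rfl, hm⟩ hi hi.1) (not_le.2 hx.2)

lemma ne_zero_between (h : EnumeratesZeros m a φ ρ) {i : ℕ} (hi : 1 ≤ i) (him : i + 1 ≤ m) {x : ℝ}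
    (hx : x ∈ Ioo (ρ i) (ρ (i + 1))) : φ x ≠ 0 := by
  intro h0
  have hi1 : i ∈ Icc 1 m := ⟨hi, by omega⟩
  have hi2 : i + 1 ∈ Icc 1 m := ⟨by omega, him⟩
  obtain ⟨n, hn, rfl⟩ := h.exists_of_zero
    ⟨(h.mem hi1).1.1.trans hx.1, hx.2.le.trans (h.mem hi2).1.2⟩ h0
  have h1 := (h.strictMonoOn.lt_iff_lt hi1 hn).1 hx.1
  have h2 := (h.strictMonoOn.lt_iff_lt hn hi2).1 hx.2
  omega

end EnumeratesZeros

/-- As the dimension tends to two, the zeros of the profiles converge to those of the limit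
profile, provided their number stays the same. -/
theorem IsEmdenProfile.tendsto_zeros (hp : 1 < p) (h₀ : IsEmdenProfile 1 p a₀ φ₀ g₀)
    (h : ∀ᶠ j in l, 1 ≤ k j ∧ IsEmdenProfile (k j) p (a j) (φ j) (g j)) (hk : Tendsto k l (𝓝 1))
    {m : ℕ} {ρ₀ : ℕ → ℝ} {ρ : ι → ℕ → ℝ} (hρ₀ : EnumeratesZeros m a₀ φ₀ ρ₀)
    (hρ : ∀ᶠ j in l, EnumeratesZeros m (a j) (φ j) (ρ j)) {i : ℕ} (hi : 1 ≤ i) (him : i ≤ m) :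
    Tendsto (fun j => ρ j i) l (𝓝 (ρ₀ i)) := by
  induction i, hi using Nat.le_induction with
  | base =>
    have h1 : 1 ∈ Icc 1 m := ⟨le_rfl, him⟩
    have hm₀ := hρ₀.mem h1
    refine tendsto_next_zero hp h₀ h hk (σ := fun _ => 0) tendsto_const_nhds le_rfl hm₀.1.1
      hm₀.1.2 hm₀.2 (fun x hx => hρ₀.ne_zero_before him hx) ?_ ⟨1, one_pos, ?_⟩
    · filter_upwards [hρ] with j hj
      exact ⟨le_rfl, (hj.mem h1).1.2, (hj.mem h1).2, fun x hx => hj.ne_zero_before him hx⟩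
    · filter_upwards [hρ, h] with j hj hj'
      have := hj.mem h1
      simpa using hj'.2.one_le_of_eq_zero hj'.1 hp ⟨this.1.1.le, this.1.2⟩ this.2
  | succ i hi ih =>
    have h1 : i ∈ Icc 1 m := ⟨hi, by omega⟩
    have h2 : i + 1 ∈ Icc 1 m := ⟨by omega, him⟩
    have hlt : i < i + 1 := Nat.lt_succ_self i
    have hm1 := hρ₀.mem h1
    have hm2 := hρ₀.mem h2
    have hlt₀ := hρ₀.strictMonoOn h1 h2 hlt
    refine tendsto_next_zero hp h₀ h hk (ih (by omega)) hm1.1.1.le hlt₀ hm2.1.2 hm2.2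
      (fun x hx => hρ₀.ne_zero_between hi him hx) ?_ ?_
    · filter_upwards [hρ] with j hj
      exact ⟨(hj.mem h1).1.1.le, (hj.mem h2).1.2, (hj.mem h2).2,
        fun x hx => hj.ne_zero_between hi him hx⟩
    · refine eventually_zero_separated hp h₀ h hk (ih (by omega)) hm1.1.1
        (hlt₀.trans_le hm2.1.2) hm1.2 ?_
      filter_upwards [hρ] with j hj
      exact ⟨(hj.mem h1).1.1.le, hj.strictMonoOn h1 h2 hlt, (hj.mem h2).1.2, (hj.mem h1).2,
        (hj.mem h2).2⟩

end Convergence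

/-! ### Nodal sets and zeros of radial functions -/

/-- Two points lie in a connected subset of the closed annulus that they span, namely the image of an
interval times a sphere under scalar multiplication. -/
lemma exists_isPreconnected_annulus {N : ℕ} (hN : 2 ≤ N) (x y : EuclideanSpace ℝ (Fin N))
    (hxy : ‖x‖ ≤ ‖y‖) :
    ∃ S : Set (EuclideanSpace ℝ (Fin N)), IsPreconnected S ∧ x ∈ S ∧ y ∈ S ∧
      ∀ v ∈ S, ‖v‖ ∈ Icc ‖x‖ ‖y‖ := by
  rcases eq_or_ne y 0 with rfl | hy
  · have hx : x = 0 := by simpa using hxy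
    subst hx
    exact ⟨{0}, isPreconnected_singleton, rfl, rfl, by simp⟩
  have hrank : 1 < Module.rank ℝ (EuclideanSpace ℝ (Fin N)) := by
    rw [← Module.finrank_eq_rank, finrank_euclideanSpace_fin]
    exact_mod_cast hN
  have hunit : ∀ v : EuclideanSpace ℝ (Fin N), v ≠ 0 →
      ‖v‖⁻¹ • v ∈ Metric.sphere (0 : EuclideanSpace ℝ (Fin N)) 1 := by
    intro v hv
    rw [mem_sphere_zero_iff_norm, norm_smul, norm_inv, norm_norm,
      inv_mul_cancel₀ (norm_ne_zero_iff.2 hv)]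
  have hsm : ∀ v : EuclideanSpace ℝ (Fin N), v ≠ 0 → ‖v‖ • (‖v‖⁻¹ • v) = v := by
    intro v hv
    rw [smul_smul, mul_inv_cancel₀ (norm_ne_zero_iff.2 hv), one_smul]
  refine ⟨(fun q : ℝ × EuclideanSpace ℝ (Fin N) => q.1 • q.2) ''
    (Icc ‖x‖ ‖y‖ ×ˢ Metric.sphere 0 1), ?_, ?_, ?_, ?_⟩
  · exact (isPreconnected_Icc.prod (isPreconnected_sphere hrank 0 1)).image _
      (by fun_prop : Continuous fun q : ℝ × EuclideanSpace ℝ (Fin N) => q.1 • q.2).continuousOn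
  · rcases eq_or_ne x 0 with rfl | hx
    · exact ⟨(0, ‖y‖⁻¹ • y), ⟨⟨by simp, by simp⟩, hunit y hy⟩, by simp⟩
    · exact ⟨(‖x‖, ‖x‖⁻¹ • x), ⟨⟨le_rfl, hxy⟩, hunit x hx⟩, hsm x hx⟩
  · exact ⟨(‖y‖, ‖y‖⁻¹ • y), ⟨⟨hxy, le_rfl⟩, hunit y hy⟩, hsm y hy⟩
  · rintro _ ⟨⟨s, v⟩, ⟨hs, hv⟩, rfl⟩
    rw [mem_sphere_zero_iff_norm] at hv
    simp only [norm_smul, hv, mul_one, Real.norm_eq_abs]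
    rwa [abs_of_nonneg ((norm_nonneg x).trans hs.1)]

/-- A radial function vanishing on the unit sphere but not at the origin has as many nodal sets as
its profile has zeros in `(0, 1]`, if these are finitely many. The number of zeros below `‖x‖` is a
locally constant function that separates the nodal sets. -/
theorem HasNodalSets.ncard_zeros {N m : ℕ} (hN : 2 ≤ N) {U : ℝ → ℝ}
    (h : HasNodalSets N m (radialFun N U)) (h0 : U 0 ≠ 0) (h1 : U 1 = 0)
    (hfin : {s : ℝ | s ∈ Ioc 0 1 ∧ U s = 0}.Finite) :
    {s : ℝ | s ∈ Ioc 0 1 ∧ U s = 0}.ncard = m := by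
  classical
  set Z := hfin.toFinset with hZ
  have hmem : ∀ s, s ∈ Z ↔ s ∈ Ioc 0 1 ∧ U s = 0 := fun s => by rw [hZ, Finite.mem_toFinset]; rfl
  rw [ncard_eq_toFinset_card _ hfin, ← hZ]
  let X := {x : EuclideanSpace ℝ (Fin N) //
    x ∈ Metric.ball (0 : EuclideanSpace ℝ (Fin N)) 1 ∧ radialFun N U x ≠ 0}
  have hX1 : ∀ x : X, ‖x.1‖ < 1 := fun x => by simpa using x.2.1
  have hXZ : ∀ x : X, ‖x.1‖ ∉ Z := fun x hx => x.2.2 ((hmem _).1 hx).2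
  have h1Z : (1 : ℝ) ∈ Z := (hmem 1).2 ⟨⟨one_pos, le_rfl⟩, h1⟩
  let F : X → ℕ := fun x => (Z.filter (· < ‖x.1‖)).card
  have hF : Continuous F := by
    refine IsLocallyConstant.continuous ((IsLocallyConstant.iff_eventually_eq F).2 fun x => ?_)
    have hn : Continuous fun y : X => ‖y.1‖ := continuous_subtype_val.norm
    have : ∀ᶠ y : X in 𝓝 x, ∀ z ∈ Z, (z < ‖y.1‖ ↔ z < ‖x.1‖) := by
      rw [Filter.eventually_all_finset]
      intro z hz
      rcases lt_or_gt_of_ne (fun hzx : z = ‖x.1‖ => hXZ x (hzx ▸ hz)) with hlt | hlt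
      · filter_upwards [hn.continuousAt.eventually_const_lt hlt] with y hy
        exact ⟨fun _ => hlt, fun _ => hy⟩
      · filter_upwards [hn.continuousAt.eventually_lt_const hlt] with y hy
        exact ⟨fun hc => absurd hc (not_lt.2 hy.le), fun hc => absurd hc (not_lt.2 hlt.le)⟩
    filter_upwards [this] with y hy
    exact congrArg Finset.card (Finset.filter_congr hy)
  have hsep : ∀ x y : X, ‖x.1‖ ≤ ‖y.1‖ → F x = F y →
      (x : ConnectedComponents X) = (y : ConnectedComponents X) := by
    intro x y hxy hFxy
    have hsub : Z.filter (· < ‖x.1‖) ⊆ Z.filter (· < ‖y.1‖) := by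
      intro z hz
      rw [Finset.mem_filter] at hz ⊢
      exact ⟨hz.1, hz.2.trans_le hxy⟩
    have heq := Finset.eq_of_subset_of_card_le hsub hFxy.ge
    obtain ⟨S, hS, hxS, hyS, hSn⟩ := exists_isPreconnected_annulus hN x.1 y.1 hxy
    have hSX : ∀ v ∈ S, v ∈ Metric.ball (0 : EuclideanSpace ℝ (Fin N)) 1 ∧ radialFun N U v ≠ 0 := by
      intro v hv
      have hvn := hSn v hv
      have hv1 : ‖v‖ < 1 := hvn.2.trans_lt (hX1 y)
      refine ⟨by simpa using hv1, fun hv0 => ?_⟩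
      have hv0 : U ‖v‖ = 0 := hv0
      have hvpos : 0 < ‖v‖ := lt_of_le_of_ne (norm_nonneg v) fun hc => h0 ((congrArg U hc).trans hv0)
      have hvZ : ‖v‖ ∈ Z := (hmem _).2 ⟨⟨hvpos, hv1.le⟩, hv0⟩
      have hvy : ‖v‖ < ‖y.1‖ := lt_of_le_of_ne hvn.2 fun hc => hXZ y (hc ▸ hvZ)
      have : ‖v‖ ∈ Z.filter (· < ‖x.1‖) := by
        rw [heq]; exact Finset.mem_filter.2 ⟨hvZ, hvy⟩
      exact absurd (Finset.mem_filter.1 this).2 (not_lt.2 hvn.1)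
    have hind : IsInducing (fun v : X => v.1) := IsEmbedding.subtypeVal.isInducing
    have hpre : IsPreconnected ((fun v : X => v.1) ⁻¹' S) := by
      refine hind.isPreconnected_image.1 ?_
      rwa [image_preimage_eq_of_subset fun v hv => ⟨⟨v, hSX v hv⟩, rfl⟩]
    rw [ConnectedComponents.coe_eq_coe']
    exact hpre.subset_connectedComponent (x := y) hyS hxS
  have hinj : Function.Injective hF.connectedComponentsLift := by
    intro c d
    obtain ⟨x, rfl⟩ := ConnectedComponents.surjective_coe c
    obtain ⟨y, rfl⟩ := ConnectedComponents.surjective_coe d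
    rw [hF.connectedComponentsLift_apply_coe, hF.connectedComponentsLift_apply_coe]
    intro hFxy
    rcases le_total ‖x.1‖ ‖y.1‖ with hxy | hxy
    · exact hsep x y hxy hFxy
    · exact (hsep y x hxy hFxy.symm).symm
  have hpoint : ∀ r : ℝ, 0 ≤ r → r < 1 → U r ≠ 0 → ∃ x : X, ‖x.1‖ = r := by
    intro r hr0 hr1 hUr
    refine ⟨⟨r • EuclideanSpace.single (⟨0, by omega⟩ : Fin N) (1 : ℝ), ?_, ?_⟩, ?_⟩
    · simpa [norm_smul, abs_of_nonneg hr0] using hr1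
    · simpa [radialFun, norm_smul, abs_of_nonneg hr0] using hUr
    · simp [norm_smul, abs_of_nonneg hr0]
  have hrange : range hF.connectedComponentsLift = (Finset.range Z.card : Set ℕ) := by
    ext j
    rw [Finset.coe_range, mem_Iio]
    constructor
    · rintro ⟨c, rfl⟩
      obtain ⟨x, rfl⟩ := ConnectedComponents.surjective_coe c
      rw [hF.connectedComponentsLift_apply_coe]
      refine Finset.card_lt_card ((Finset.filter_ssubset).2 ⟨1, h1Z, not_lt.2 (hX1 x).le⟩)
    · intro hj
      suffices ∃ r : ℝ, 0 ≤ r ∧ r < 1 ∧ U r ≠ 0 ∧ (Z.filter (· < r)).card = j by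
        obtain ⟨r, hr0, hr1, hUr, hcard⟩ := this
        obtain ⟨x, rfl⟩ := hpoint r hr0 hr1 hUr
        exact ⟨x, by rw [hF.connectedComponentsLift_apply_coe]; exact hcard⟩
      rcases Nat.eq_zero_or_pos j with rfl | hjpos
      · refine ⟨0, le_rfl, one_pos, h0, ?_⟩
        rw [Finset.card_eq_zero, Finset.filter_eq_empty_iff]
        intro z hz
        exact not_lt.2 ((hmem z).1 hz).1.1.le
      · set e := Z.orderEmbOfFin rfl with he
        set a := e ⟨j - 1, by omega⟩ with ha
        set b := e ⟨j, hj⟩ with hb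
        have hab : a < b := e.strictMono (by rw [Fin.lt_def]; simp only; omega)
        have haZ := (hmem a).1 (Z.orderEmbOfFin_mem rfl _)
        have hbZ := (hmem b).1 (Z.orderEmbOfFin_mem rfl _)
        have hlt : ∀ i : Fin Z.card, e i < (a + b) / 2 ↔ i < ⟨j, hj⟩ := by
          intro i
          constructor
          · intro hi
            exact e.lt_iff_lt.1 (hi.trans (by linarith))
          · intro hi
            have : e i ≤ a := e.monotone (by rw [Fin.le_def]; rw [Fin.lt_def] at hi; simp only at *; omega)
            linarith
        refine ⟨(a + b) / 2, by linarith [haZ.1.1], by linarith [hbZ.1.2], fun hU => ?_, ?_⟩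
        · have hmid : (a + b) / 2 ∈ range e := by
            rw [he, Finset.range_orderEmbOfFin]
            exact (hmem _).2 ⟨⟨by linarith [haZ.1.1], by linarith [hbZ.1.2]⟩, hU⟩
          obtain ⟨i, hi⟩ := hmid
          have h2 : i < ⟨j, hj⟩ := e.lt_iff_lt.1 (by rw [hi]; linarith)
          have h3 := (hlt i).2 h2
          rw [hi] at h3
          exact lt_irrefl _ h3
        · have : Z.filter (· < (a + b) / 2) = (Finset.Iio (⟨j, hj⟩ : Fin Z.card)).map e.toEmbedding := by
            ext z
            rw [Finset.mem_filter, Finset.mem_map]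
            constructor
            · rintro ⟨hz, hz'⟩
              have : z ∈ range e := by rw [he, Finset.range_orderEmbOfFin]; exact hz
              obtain ⟨i, rfl⟩ := this
              exact ⟨i, Finset.mem_Iio.2 ((hlt i).1 hz'), rfl⟩
            · rintro ⟨i, hi, rfl⟩
              exact ⟨Z.orderEmbOfFin_mem rfl i, (hlt i).2 (Finset.mem_Iio.1 hi)⟩
          rw [this, Finset.card_map, Fin.card_Iio]
  have hcard := Nat.card_range_of_injective hinj
  rw [hrange] at hcard
  have hN' : Nat.card (ConnectedComponents X) = m := h
  rw [hN'] at hcard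
  simpa using hcard

/-- A finite set of reals can be listed increasingly by the indices `1, …, m`. -/
lemma exists_strictMonoOn_image_eq {m : ℕ} {Z : Set ℝ} (hfin : Z.Finite) (hm : Z.ncard = m) :
    ∃ z : ℕ → ℝ, StrictMonoOn z (Icc 1 m) ∧ z '' Icc 1 m = Z := by
  classical
  have hcard : hfin.toFinset.card = m := by rw [← ncard_eq_toFinset_card _ hfin, hm]
  set e := hfin.toFinset.orderEmbOfFin hcard with he
  refine ⟨fun i => if h : i - 1 < m then e ⟨i - 1, h⟩ else 0, ?_, ?_⟩
  · intro i hi j hj hij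
    have h1 : i - 1 < m := by have := hi.1; have := hi.2; omega
    have h2 : j - 1 < m := by have := hj.1; have := hj.2; omega
    simp only [h1, h2, dif_pos]
    refine e.strictMono ?_
    have := hi.1
    rw [Fin.lt_def]; simp only; omega
  · have hr : range e = Z := by rw [he, Finset.range_orderEmbOfFin]; simp
    rw [← hr]
    ext s
    constructor
    · rintro ⟨i, hi, rfl⟩
      have h1 : i - 1 < m := by have := hi.1; have := hi.2; omega
      exact ⟨⟨i - 1, h1⟩, by simp [h1]⟩
    · rintro ⟨i, rfl⟩
      exact ⟨i + 1, ⟨by omega, i.2⟩, by simp⟩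

/-! ### The radial equation -/

/-- The second derivative along a line, read off from a formula for the first one. -/
lemma iteratedFDeriv_two_eq_of_line {E : Type*} [NormedAddCommGroup E] [NormedSpace ℝ E] {f : E → ℝ}
    {x v : E} (hf : ContDiffAt ℝ 2 f x) {G : ℝ → ℝ} {c : ℝ}
    (hG : ∀ᶠ t in 𝓝 (0 : ℝ), HasDerivAt (fun t : ℝ => f (x + t • v)) (G t) t)
    (hc : HasDerivAt G c 0) : iteratedFDeriv ℝ 2 f x ![v, v] = c := by
  have hline : ∀ t : ℝ, HasDerivAt (fun t : ℝ => x + t • v) v t := fun t => by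
    simpa using ((hasDerivAt_id t).smul_const v).const_add x
  have hlim : Tendsto (fun t : ℝ => x + t • v) (𝓝 0) (𝓝 x) := by
    simpa using (hline 0).continuousAt.tendsto
  have hd : ∀ᶠ y in 𝓝 x, DifferentiableAt ℝ f y := by
    filter_upwards [hf.eventually (by simp)] with y hy
    exact hy.differentiableAt (by norm_num)
  have hG' : G =ᶠ[𝓝 0] fun t => fderiv ℝ f (x + t • v) v := by
    filter_upwards [hG, hlim.eventually hd] with t ht hdt
    exact ht.unique (hdt.hasFDerivAt.comp_hasDerivAt t (hline t))
  have h2 : DifferentiableAt ℝ (fderiv ℝ f) x :=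
    (hf.fderiv_right (m := 1) (by norm_num)).differentiableAt (by norm_num)
  have h3 : HasDerivAt (fun t : ℝ => fderiv ℝ f (x + t • v)) (fderiv ℝ (fderiv ℝ f) x v) 0 := by
    have h4 : HasFDerivAt (fderiv ℝ f) (fderiv ℝ (fderiv ℝ f) x) (x + (0 : ℝ) • v) := by
      simpa using h2.hasFDerivAt
    exact h4.comp_hasDerivAt 0 (hline 0)
  have h5 : HasDerivAt (fun t : ℝ => fderiv ℝ f (x + t • v) v) (fderiv ℝ (fderiv ℝ f) x v v) 0 := by
    simpa using h3.clm_apply (hasDerivAt_const (0 : ℝ) v)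
  rw [iteratedFDeriv_two_apply]
  simpa using (h5.congr_of_eventuallyEq hG').unique hc

lemma norm_axis_add {N : ℕ} {i j : Fin N} (hij : i ≠ j) (r t : ℝ) :
    ‖r • EuclideanSpace.single i (1 : ℝ) + t • EuclideanSpace.single j (1 : ℝ)‖
      = √(r ^ 2 + t ^ 2) := by
  rw [eq_comm, Real.sqrt_eq_iff_mul_self_eq (by positivity) (norm_nonneg _), norm_add_mul_self_real]
  have : inner ℝ (EuclideanSpace.single i (1 : ℝ)) (EuclideanSpace.single j (1 : ℝ)) = 0 := by
    simp [EuclideanSpace.inner_single_left, hij]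
  simp [norm_smul, inner_smul_left, inner_smul_right, this, pow_two]

/-- The Laplacian of a radial function at the point at distance `r` on a coordinate axis. -/
lemma laplacian_radialFun {N : ℕ} {U : ℝ → ℝ} {r : ℝ} (hr : 0 < r) (i₀ : Fin N)
    (hf : ContDiffAt ℝ 2 (radialFun N U) (r • EuclideanSpace.single i₀ (1 : ℝ)))
    (hU : ContDiffAt ℝ 2 U r) :
    (Laplacian.laplacian (radialFun N U) : EuclideanSpace ℝ (Fin N) → ℝ)
      (r • EuclideanSpace.single i₀ (1 : ℝ)) = deriv (deriv U) r + (N - 1) * (deriv U r / r) := by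
  have hdU : ∀ᶠ s in 𝓝 r, HasDerivAt U (deriv U s) s := by
    filter_upwards [hU.eventually (by simp)] with s hs
    exact (hs.differentiableAt (by norm_num)).hasDerivAt
  have hddU : HasDerivAt (deriv U) (deriv (deriv U) r) r :=
    ((hU.derivWithin (m := 1) (by norm_num)).differentiableAt (by norm_num)).hasDerivAt
  rw [InnerProductSpace.laplacian_eq_iteratedFDeriv_orthonormalBasis _
    (EuclideanSpace.basisFun (Fin N) ℝ)]
  simp only [EuclideanSpace.basisFun_apply]
  have hradial : iteratedFDeriv ℝ 2 (radialFun N U) (r • EuclideanSpace.single i₀ (1 : ℝ))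
      ![EuclideanSpace.single i₀ (1 : ℝ), EuclideanSpace.single i₀ (1 : ℝ)]
      = deriv (deriv U) r := by
    have hlim : Tendsto (fun t : ℝ => r + t) (𝓝 0) (𝓝 r) := by
      simpa using (by fun_prop : Continuous fun t : ℝ => r + t).tendsto 0
    refine iteratedFDeriv_two_eq_of_line hf (G := fun t => deriv U (r + t)) ?_ ?_
    · have heq : ∀ᶠ t in 𝓝 (0 : ℝ), ∀ᶠ s in 𝓝 t, radialFun N U (r • EuclideanSpace.single i₀ (1 : ℝ)
          + s • EuclideanSpace.single i₀ (1 : ℝ)) = U (r + s) := by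
        refine (hlim.eventually_const_lt hr).eventually_nhds.mono fun t ht => ?_
        filter_upwards [ht] with s hs
        rw [radialFun, ← add_smul, norm_smul]
        simp [abs_of_pos hs]
      filter_upwards [heq, hlim.eventually hdU] with t ht1 ht2
      exact (HasDerivAt.comp_const_add r t ht2).congr_of_eventuallyEq ht1
    · exact HasDerivAt.comp_const_add r 0 (by simpa using hddU)
  have hangular : ∀ i : Fin N, i ≠ i₀ →
      iteratedFDeriv ℝ 2 (radialFun N U) (r • EuclideanSpace.single i₀ (1 : ℝ))
        ![EuclideanSpace.single i (1 : ℝ), EuclideanSpace.single i (1 : ℝ)] = deriv U r / r := by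
    intro i hi
    have hq : ∀ t : ℝ, HasDerivAt (fun t : ℝ => √(r ^ 2 + t ^ 2)) (t / √(r ^ 2 + t ^ 2)) t := by
      intro t
      have h1 : HasDerivAt (fun t : ℝ => r ^ 2 + t ^ 2) (2 * t) t := by
        simpa using (hasDerivAt_pow 2 t).const_add (r ^ 2)
      refine (h1.sqrt (by positivity)).congr_deriv ?_
      rw [mul_div_mul_left _ _ two_ne_zero]
    have hq0 : √(r ^ 2 + (0 : ℝ) ^ 2) = r := by simp [Real.sqrt_sq hr.le]
    have hlim : Tendsto (fun t : ℝ => √(r ^ 2 + t ^ 2)) (𝓝 0) (𝓝 r) := by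
      have := (hq 0).continuousAt.tendsto
      rwa [hq0] at this
    refine iteratedFDeriv_two_eq_of_line hf
      (G := fun t => deriv U (√(r ^ 2 + t ^ 2)) / √(r ^ 2 + t ^ 2) * t) ?_ ?_
    · filter_upwards [hlim.eventually hdU] with t ht
      have h1 : (fun s : ℝ => radialFun N U (r • EuclideanSpace.single i₀ (1 : ℝ)
          + s • EuclideanSpace.single i (1 : ℝ))) = U ∘ fun s => √(r ^ 2 + s ^ 2) := by
        funext s
        rw [radialFun, norm_axis_add hi.symm, Function.comp_apply]
      rw [h1]
      exact (ht.comp t (hq t)).congr_deriv (by ring)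
    · have hcont : ContinuousAt (fun t : ℝ => deriv U (√(r ^ 2 + t ^ 2)) / √(r ^ 2 + t ^ 2)) 0 := by
        refine ContinuousAt.div ?_ (hq 0).continuousAt (by rw [hq0]; exact hr.ne')
        exact ContinuousAt.comp (g := deriv U) (by rw [hq0]; exact hddU.continuousAt)
          (hq 0).continuousAt
      have := hasDerivAt_mul_self_zero hcont
      rwa [hq0] at this
  rw [← Finset.add_sum_erase _ _ (Finset.mem_univ i₀), hradial,
    Finset.sum_congr rfl fun i hi => hangular i (Finset.ne_of_mem_erase hi), Finset.sum_const,
    Finset.card_erase_of_mem (Finset.mem_univ _), Finset.card_univ, Fintype.card_fin, nsmul_eq_mul,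
    Nat.cast_pred (Nat.pos_of_ne_zero fun h => by subst h; exact i₀.elim0)]

/-- `U`, with derivative `V`, solves on `(0, 1)` the radial form
`U'' + ((N-1)/r) U' + r^α |U|^{p-1} U = 0` of the Hénon equation, is of class `C¹` up to the
endpoints, and vanishes at `1`. -/
structure IsRadialHenon (N : ℕ) (α p : ℝ) (U V : ℝ → ℝ) : Prop where
  continuousOn : ContinuousOn U (Icc 0 1)
  continuousOn_deriv : ContinuousOn V (Icc 0 1)
  hasDerivAt : ∀ r ∈ Ioo 0 1, HasDerivAt U (V r) r
  hasDerivAt_deriv : ∀ r ∈ Ioo 0 1,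
    HasDerivAt V (-((N - 1) * (V r / r)) - r ^ α * oddPow p (U r)) r
  one : U 1 = 0

lemma IsDirichletSolution.isRadialHenon {N : ℕ} (hN : 2 ≤ N) {α p : ℝ} {U : ℝ → ℝ}
    (h : IsDirichletSolution N (fun x => ‖x‖ ^ α) p (radialFun N U)) :
    IsRadialHenon N α p U (derivWithin U (Icc 0 1)) := by
  set i₀ : Fin N := ⟨0, by omega⟩
  have hnorm : ∀ s : ℝ, 0 ≤ s → ‖s • EuclideanSpace.single i₀ (1 : ℝ)‖ = s := by
    intro s hs
    rw [norm_smul]; simp [abs_of_nonneg hs]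
  have hUC : ContDiffOn ℝ 2 U (Icc 0 1) := by
    have h1 : ContDiff ℝ 2 fun s : ℝ => s • EuclideanSpace.single i₀ (1 : ℝ) := by fun_prop
    have h2 := h.contDiffOn.comp (t := Metric.closedBall 0 1) (s := Icc (0 : ℝ) 1) h1.contDiffOn
      (fun s hs => by
        rw [mem_closedBall_zero_iff, hnorm s hs.1]; exact hs.2)
    refine h2.congr fun s hs => ?_
    rw [Function.comp_apply, radialFun, hnorm s hs.1]
  have hVC : ContDiffOn ℝ 1 (derivWithin U (Icc 0 1)) (Icc 0 1) :=
    hUC.derivWithin (uniqueDiffOn_Icc one_pos) (by norm_num)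
  have hV : ∀ r ∈ Ioo (0 : ℝ) 1, derivWithin U (Icc 0 1) =ᶠ[𝓝 r] deriv U := by
    intro r hr
    filter_upwards [Ioo_mem_nhds hr.1 hr.2] with s hs
    exact derivWithin_of_mem_nhds (Icc_mem_nhds hs.1 hs.2)
  have hUat : ∀ r ∈ Ioo (0 : ℝ) 1, ContDiffAt ℝ 2 U r := fun r hr =>
    hUC.contDiffAt (Icc_mem_nhds hr.1 hr.2)
  refine ⟨hUC.continuousOn, hVC.continuousOn, fun r hr => ?_, fun r hr => ?_, ?_⟩
  · rw [(hV r hr).eq_of_nhds]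
    exact ((hUat r hr).differentiableAt (by norm_num)).hasDerivAt
  · have hball : r • EuclideanSpace.single i₀ (1 : ℝ) ∈
        Metric.ball (0 : EuclideanSpace ℝ (Fin N)) 1 := by
      rw [mem_ball_zero_iff, hnorm r hr.1.le]; exact hr.2
    have hlap := laplacian_radialFun hr.1 i₀ (h.contDiffOn.contDiffAt (mem_of_superset
      (Metric.isOpen_ball.mem_nhds hball) Metric.ball_subset_closedBall)) (hUat r hr)
    have heq := h.equation _ hball
    rw [hlap, radialFun, hnorm r hr.1.le] at heq
    have hd : HasDerivAt (derivWithin U (Icc 0 1)) (deriv (derivWithin U (Icc 0 1)) r) r :=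
      ((hVC.contDiffAt (Icc_mem_nhds hr.1 hr.2)).differentiableAt (by norm_num)).hasDerivAt
    refine hd.congr_deriv ?_
    rw [(hV r hr).deriv_eq, (hV r hr).eq_of_nhds, oddPow]
    linarith
  · have := h.boundary ((1 : ℝ) • EuclideanSpace.single i₀ (1 : ℝ)) (by
      rw [mem_sphere_zero_iff_norm, hnorm 1 zero_le_one])
    rwa [radialFun, hnorm 1 zero_le_one] at this

/-! ### From the Hénon equation to profiles in fractional dimension -/

/-- The exponent `θ = 2 / (α + 2)` of the substitution `r = (x / a)^θ`. -/
noncomputable def henonExponent (α : ℝ) : ℝ := 2 / (α + 2)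

/-- The length of the interval on which the normalised profile of a solution with central value
`c` is defined. -/
noncomputable def profileRadius (α p c : ℝ) : ℝ := henonExponent α * c ^ ((p - 1) / 2)

/-- The solution `U`, rescaled in height by `U 0` and in the radius by `r = (x / a)^θ`; this
removes the weight `r^α`. -/
noncomputable def henonProfile (α p : ℝ) (U : ℝ → ℝ) (x : ℝ) : ℝ :=
  U ((x / profileRadius α p (U 0)) ^ henonExponent α) / U 0

/-- The derivative of `henonProfile`, where `V` is that of `U`. At `x = 0` the division by zero
yields the correct value `0`. -/
noncomputable def henonProfileDeriv (α p : ℝ) (U V : ℝ → ℝ) (x : ℝ) : ℝ :=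
  V ((x / profileRadius α p (U 0)) ^ henonExponent α) *
    (henonExponent α * (x / profileRadius α p (U 0)) ^ henonExponent α / x) / U 0

lemma henonExponent_pos {α : ℝ} (hα : 0 ≤ α) : 0 < henonExponent α := by
  unfold henonExponent; positivity

lemma profileRadius_pos {α p c : ℝ} (hα : 0 ≤ α) (hc : 0 < c) : 0 < profileRadius α p c :=
  mul_pos (henonExponent_pos hα) (Real.rpow_pos_of_pos hc _)

lemma oddPow_div {p c : ℝ} (hc : 0 < c) (t : ℝ) :
    oddPow p (t / c) = oddPow p t / (c ^ (p - 1) * c) := by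
  rw [oddPow, oddPow, abs_div, abs_of_pos hc, Real.div_rpow (abs_nonneg t) hc.le, div_mul_div_comm]

/-- The rescaled solution is a normalised profile in dimension `2 + (N - 2) θ`. -/
theorem IsRadialHenon.isEmdenProfile {N : ℕ} (hN : 2 ≤ N) {α p : ℝ} (hα : 0 ≤ α) (hp : 1 < p)
    {U V : ℝ → ℝ} (h : IsRadialHenon N α p U V) (h0 : 0 < U 0) :
    IsEmdenProfile (1 + (N - 2) * henonExponent α) p (profileRadius α p (U 0))
      (henonProfile α p U) (henonProfileDeriv α p U V) := by
  have ha := profileRadius_pos (p := p) hα h0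
  have hθ := henonExponent_pos hα
  have hN' : (2 : ℝ) ≤ N := by exact_mod_cast hN
  have hk : 1 ≤ 1 + ((N : ℝ) - 2) * henonExponent α := by nlinarith
  have hsq : profileRadius α p (U 0) ^ 2 = henonExponent α ^ 2 * U 0 ^ (p - 1) := by
    rw [profileRadius, mul_pow, ← Real.rpow_mul_natCast h0.le]
    congr 2
    push_cast
    ring
  have hθα : henonExponent α * (α + 2) = 2 := by
    unfold henonExponent; field_simp
  unfold henonProfile henonProfileDeriv
  set a := profileRadius α p (U 0)
  set θ := henonExponent α
  set k := 1 + ((N : ℝ) - 2) * θ with hkdef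
  have hρI : ∀ x ∈ Icc 0 a, (x / a) ^ θ ∈ Icc (0 : ℝ) 1 := fun x hx =>
    ⟨Real.rpow_nonneg (div_nonneg hx.1 ha.le) _,
      Real.rpow_le_one (div_nonneg hx.1 ha.le) ((div_le_one ha).2 hx.2) hθ.le⟩
  have hρO : ∀ x ∈ Ioo 0 a, (x / a) ^ θ ∈ Ioo (0 : ℝ) 1 := fun x hx =>
    ⟨Real.rpow_pos_of_pos (div_pos hx.1 ha) _,
      Real.rpow_lt_one (div_pos hx.1 ha).le ((div_lt_one ha).2 hx.2) hθ⟩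
  have hρc : Continuous fun x : ℝ => (x / a) ^ θ :=
    (continuous_id.div_const a).rpow_const fun _ => Or.inr hθ.le
  have hρd : ∀ x, 0 < x → HasDerivAt (fun x : ℝ => (x / a) ^ θ) (θ * (x / a) ^ θ / x) x := by
    intro x hx
    have hxa : x / a ≠ 0 := (div_pos hx ha).ne'
    refine (((hasDerivAt_id x).div_const a).rpow_const (Or.inl hxa)).congr_deriv ?_
    rw [id, Real.rpow_sub_one hxa]
    field_simp
  have hφc : ContinuousOn (fun x => U ((x / a) ^ θ) / U 0) (Icc 0 a) :=
    (h.continuousOn.comp hρc.continuousOn hρI).div_const _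
  have hVc : ContinuousOn (fun x => V ((x / a) ^ θ)) (Icc 0 a) :=
    h.continuousOn_deriv.comp hρc.continuousOn hρI
  have hg' : ∀ x ∈ Ioo 0 a, HasDerivAt
      (fun x => V ((x / a) ^ θ) * (θ * (x / a) ^ θ / x) / U 0)
      (-(k / x) * (V ((x / a) ^ θ) * (θ * (x / a) ^ θ / x) / U 0)
        - oddPow p (U ((x / a) ^ θ) / U 0)) x := by
    intro x hx
    have h1 := (h.hasDerivAt_deriv _ (hρO x hx)).comp x (hρd x hx.1)
    have h2 := ((hρd x hx.1).const_mul θ).div (hasDerivAt_id x) hx.1.ne'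
    refine ((h1.mul h2).div_const (U 0)).congr_deriv ?_
    have hR := (hρO x hx).1
    have hx0 := hx.1.ne'
    have hP : 0 < U 0 ^ (p - 1) := Real.rpow_pos_of_pos h0 _
    have hweight : ((x / a) ^ θ) ^ α * ((x / a) ^ θ) ^ 2 * (θ ^ 2 * U 0 ^ (p - 1)) = x ^ 2 := by
      rw [← Real.rpow_natCast, ← Real.rpow_add hR, ← Real.rpow_mul (div_pos hx.1 ha).le,
        Nat.cast_ofNat, hθα, Real.rpow_two, ← hsq, div_pow]
      field_simp
    rw [oddPow_div h0, hkdef]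
    simp only [Function.comp_apply, Pi.div_apply, id]
    set R := (x / a) ^ θ
    set Q := R ^ α
    set P := U 0 ^ (p - 1)
    field_simp
    linear_combination (-oddPow p (U R)) * hweight
  have hbase : ContinuousOn
      (fun x => x ^ k * (V ((x / a) ^ θ) * (θ * (x / a) ^ θ / x) / U 0)) (Icc 0 a) := by
    have hc : ContinuousOn (fun x => x ^ (k - 1) * (V ((x / a) ^ θ) * (θ * (x / a) ^ θ) / U 0))
        (Icc 0 a) :=
      (Real.continuous_rpow_const (by linarith)).continuousOn.mul
        ((hVc.mul (hρc.const_mul θ).continuousOn).div_const _)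
    refine hc.congr fun x hx => ?_
    rcases hx.1.eq_or_lt with rfl | hx0
    · simp [Real.zero_rpow hθ.ne']
    · simp only
      rw [Real.rpow_sub_one hx0.ne']
      field_simp
  -- near the origin, continuity of the derivative comes from the integrated equation
  have hgc : ContinuousOn (fun x => V ((x / a) ^ θ) * (θ * (x / a) ^ θ / x) / U 0) (Icc 0 a) := by
    obtain ⟨B, hB⟩ := isCompact_Icc.exists_bound_of_continuousOn
      ((continuous_oddPow hp).comp_continuousOn hφc)
    have hlin := fun x (hx : x ∈ Ioc 0 a) => abs_le_mul_of_radial hk hbase hg'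
      (fun y hy => hB y (Ioo_subset_Icc_self hy)) hx
    intro x hx
    rcases hx.1.eq_or_lt with rfl | hx0
    · have hlim : Tendsto (fun x : ℝ => B * x) (𝓝[Icc 0 a] 0) (𝓝 0) := by
        have : Tendsto (fun x : ℝ => B * x) (𝓝 0) (𝓝 (B * 0)) := (continuous_const_mul B).tendsto 0
        rw [mul_zero] at this
        exact this.mono_left nhdsWithin_le_nhds
      rw [ContinuousWithinAt, div_zero, mul_zero, zero_div]
      refine squeeze_zero_norm' ?_ hlim
      filter_upwards [self_mem_nhdsWithin] with y hy
      rcases hy.1.eq_or_lt with rfl | hy0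
      · simp
      · exact hlin y ⟨hy0, hy.2⟩
    · exact ((hVc x hx).mul ((hρc.const_mul θ).continuousWithinAt.div
        continuousWithinAt_id hx0.ne')).div_const _
  refine ⟨ha, hφc, hgc, fun x hx => ?_, hg', ?_, ?_⟩
  · exact (((h.hasDerivAt _ (hρO x hx)).comp x (hρd x hx.1)).div_const _)
  · simp [Real.zero_rpow hθ.ne', h0.ne']
  · simp

/-- The point of the profile corresponding to the radius `r`. -/
noncomputable def profilePoint (α p c r : ℝ) : ℝ := profileRadius α p c * r ^ ((α + 2) / 2)

section ProfilePoint

variable {α p c : ℝ}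

lemma profilePoint_one : profilePoint α p c 1 = profileRadius α p c := by
  simp [profilePoint]

lemma profilePoint_strictMonoOn (hα : 0 ≤ α) (hc : 0 < c) :
    StrictMonoOn (profilePoint α p c) (Ici 0) := fun _ hr _ _ hrs =>
  mul_lt_mul_of_pos_left (Real.rpow_lt_rpow hr hrs (by linarith)) (profileRadius_pos hα hc)

lemma profilePoint_mem_Icc (hα : 0 ≤ α) (hc : 0 < c) {r : ℝ} (hr : r ∈ Icc 0 1) :
    profilePoint α p c r ∈ Icc 0 (profileRadius α p c) :=
  ⟨mul_nonneg (profileRadius_pos hα hc).le (Real.rpow_nonneg hr.1 _),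
    mul_le_of_le_one_right (profileRadius_pos hα hc).le (Real.rpow_le_one hr.1 hr.2 (by linarith))⟩

/-- Every point of the profile comes from a radius. -/
lemma exists_profilePoint_eq (hα : 0 ≤ α) (hc : 0 < c) {x : ℝ}
    (hx : x ∈ Icc 0 (profileRadius α p c)) : ∃ r ∈ Icc (0 : ℝ) 1, profilePoint α p c r = x := by
  have ha := profileRadius_pos (p := p) hα hc
  have hxa : 0 ≤ x / profileRadius α p c := div_nonneg hx.1 ha.le
  refine ⟨(x / profileRadius α p c) ^ henonExponent α, ⟨Real.rpow_nonneg hxa _,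
    Real.rpow_le_one hxa ((div_le_one ha).2 hx.2) (henonExponent_pos hα).le⟩, ?_⟩
  rw [profilePoint, ← Real.rpow_mul hxa, henonExponent,
    show 2 / (α + 2) * ((α + 2) / 2) = 1 by field_simp, Real.rpow_one]
  field_simp

lemma henonProfile_profilePoint (hα : 0 ≤ α) {U : ℝ → ℝ} (h0 : 0 < U 0) {r : ℝ} (hr : 0 ≤ r) :
    U r = U 0 * henonProfile α p U (profilePoint α p (U 0) r) := by
  have ha := profileRadius_pos (p := p) hα h0
  rw [henonProfile, profilePoint, mul_div_cancel_left₀ _ ha.ne', ← Real.rpow_mul hr, henonExponent,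
    show (α + 2) / 2 * (2 / (α + 2)) = 1 by field_simp, Real.rpow_one]
  field_simp

/-- The central value in terms of the length of the profile. -/
lemma henonExponent_rpow_mul (hα : 0 ≤ α) (hp : 1 < p) (hc : 0 < c) :
    henonExponent α ^ (2 / (p - 1)) * c = profileRadius α p c ^ (2 / (p - 1)) := by
  have hp' : p - 1 ≠ 0 := by linarith
  rw [profileRadius, Real.mul_rpow (henonExponent_pos hα).le (Real.rpow_nonneg hc.le _),
    ← Real.rpow_mul hc.le, show (p - 1) / 2 * (2 / (p - 1)) = 1 by field_simp, Real.rpow_one]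

end ProfilePoint

/-! ### Zeros and extremal values of a solution -/

/-- The zeros of a radial nodal solution can be enumerated. -/
lemma exists_isZeroEnumeration {N : ℕ} (hN : 2 ≤ N) {α p : ℝ} (hα : 0 ≤ α) (hp : 1 < p) {m : ℕ}
    (hm : 1 ≤ m) {U V : ℝ → ℝ} (h : IsRadialHenon N α p U V) (h0 : 0 < U 0)
    (hn : HasNodalSets N m (radialFun N U)) : ∃ z, IsZeroEnumeration m U z := by
  have hprof := h.isEmdenProfile hN hα hp h0
  have hN' : (2 : ℝ) ≤ N := by exact_mod_cast hN
  have hk : 1 ≤ 1 + ((N : ℝ) - 2) * henonExponent α := by nlinarith [henonExponent_pos hα]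
  have hfin : {s : ℝ | s ∈ Ioc 0 1 ∧ U s = 0}.Finite := by
    refine Finite.of_finite_image ((hprof.finite_zeros hk hp).subset ?_)
      (((profilePoint_strictMonoOn (p := p) hα h0).injOn).mono fun s hs => hs.1.1.le)
    rintro _ ⟨s, ⟨hs, hUs⟩, rfl⟩
    refine ⟨profilePoint_mem_Icc hα h0 ⟨hs.1.le, hs.2⟩, ?_⟩
    have := henonProfile_profilePoint (p := p) hα h0 hs.1.le
    rw [hUs, eq_comm] at this
    exact (mul_eq_zero.1 this).resolve_left h0.ne'
  obtain ⟨z, hz1, hz2⟩ := exists_strictMonoOn_image_eq hfin (hn.ncard_zeros hN h0.ne' h.one hfin)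
  refine ⟨z, hz1, hz2, ?_⟩
  have h1 : (1 : ℝ) ∈ z '' Icc 1 m := by rw [hz2]; exact ⟨⟨one_pos, le_rfl⟩, h.one⟩
  have h2 : z m ∈ {s : ℝ | s ∈ Ioc 0 1 ∧ U s = 0} := by rw [← hz2]; exact ⟨m, ⟨hm, le_rfl⟩, rfl⟩
  obtain ⟨i, hi, hi1⟩ := h1
  exact le_antisymm h2.1.2 (hi1 ▸ hz1.monotoneOn hi ⟨hm, le_rfl⟩ hi.2)

lemma IsZeroEnumeration.mem {m : ℕ} {U : ℝ → ℝ} {z : ℕ → ℝ} (hz : IsZeroEnumeration m U z) {i : ℕ}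
    (hi : i ∈ Icc 1 m) : z i ∈ Ioc 0 1 ∧ U (z i) = 0 := by
  have : z i ∈ z '' Icc 1 m := ⟨i, hi, rfl⟩
  rwa [hz.image_eq] at this

/-- The zeros of a solution correspond to those of its profile. -/
lemma IsZeroEnumeration.enumeratesZeros {α p : ℝ} (hα : 0 ≤ α) {m : ℕ} {U : ℝ → ℝ} (h0 : 0 < U 0)
    {z : ℕ → ℝ} (hz : IsZeroEnumeration m U z) :
    EnumeratesZeros m (profileRadius α p (U 0)) (henonProfile α p U)
      (fun i => profilePoint α p (U 0) (z i)) := by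
  have hmono := profilePoint_strictMonoOn (p := p) hα h0
  refine ⟨fun i hi j hj hij => hmono (hz.mem hi).1.1.le (hz.mem hj).1.1.le
    (hz.strictMonoOn hi hj hij), ?_⟩
  have hzero : ∀ r, 0 ≤ r → (U r = 0 ↔ henonProfile α p U (profilePoint α p (U 0) r) = 0) := by
    intro r hr
    rw [henonProfile_profilePoint (p := p) hα h0 hr, mul_eq_zero, or_iff_right h0.ne']
  have h00 : profilePoint α p (U 0) 0 = 0 := by
    rw [profilePoint, Real.zero_rpow (by linarith), mul_zero]
  ext x
  constructor
  · rintro ⟨i, hi, rfl⟩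
    have h1 := hz.mem hi
    refine ⟨⟨?_, (profilePoint_mem_Icc hα h0 ⟨h1.1.1.le, h1.1.2⟩).2⟩, (hzero _ h1.1.1.le).1 h1.2⟩
    have h2 := hmono self_mem_Ici h1.1.1.le h1.1.1
    rwa [h00] at h2
  · rintro ⟨hx, hx0⟩
    obtain ⟨r, hr, rfl⟩ := exists_profilePoint_eq hα h0 ⟨hx.1.le, hx.2⟩
    have hr0 : 0 < r := lt_of_le_of_ne hr.1 fun hc => by
      rw [← hc, h00] at hx; exact lt_irrefl _ hx.1
    have : r ∈ z '' Icc 1 m := by rw [hz.image_eq]; exact ⟨⟨hr0, hr.2⟩, (hzero r hr.1).2 hx0⟩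
    obtain ⟨i, hi, rfl⟩ := this
    exact ⟨i, hi, rfl⟩

lemma exists_isExtremalValues {m : ℕ} (hm : 1 ≤ m) {U : ℝ → ℝ} (hU : ContinuousOn U (Icc 0 1))
    {z : ℕ → ℝ} (hz : IsZeroEnumeration m U z) : ∃ M, IsExtremalValues m U z M := by
  refine ⟨fun i => if i = 1 then sSup (U '' Icc 0 (z 1)) else
    sSup ((fun s => |U s|) '' Icc (z (i - 1)) (z i)), ?_, ?_⟩
  · have h1 := (hz.mem ⟨le_rfl, hm⟩).1
    rw [if_pos rfl]
    exact (isCompact_Icc.image_of_continuousOn (hU.mono (Icc_subset_Icc_right h1.2))).isGreatest_sSup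
      ((nonempty_Icc.2 h1.1.le).image _)
  · intro i hi him
    have h1 := (hz.mem (i := i) ⟨hi, by omega⟩).1
    have h2 := (hz.mem (i := i + 1) ⟨by omega, him⟩).1
    have h3 := hz.strictMonoOn (a := i) (b := i + 1) ⟨hi, by omega⟩ ⟨by omega, him⟩ (Nat.lt_succ_self i)
    simp only [if_neg (by omega : i + 1 ≠ 1), Nat.add_sub_cancel]
    exact (isCompact_Icc.image_of_continuousOn
      (hU.mono (Icc_subset_Icc h1.1.le h2.2)).abs).isGreatest_sSup ((nonempty_Icc.2 h3.le).image _)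

/-! ### Asymptotics of the rescaled quantities -/

lemma tendsto_henonExponent : Tendsto henonExponent atTop (𝓝 0) :=
  tendsto_const_nhds.div_atTop (tendsto_atTop_add_const_right _ _ tendsto_id)

lemma tendsto_mul_henonExponent : Tendsto (fun α => α * henonExponent α) atTop (𝓝 2) := by
  have h : Tendsto (fun α : ℝ => 2 - 2 * henonExponent α) atTop (𝓝 2) := by
    simpa using (tendsto_henonExponent.const_mul 2).const_sub 2
  refine h.congr' ?_
  filter_upwards [eventually_ge_atTop 0] with α hα
  unfold henonExponent
  field_simp
  ring

/-- If `z^{(α+2)/2} → t > 0`, then `α (1 - z) → -2 log t`; squeezed between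
`-z log z ≤ 1 - z ≤ -log z`. -/
lemma tendsto_mul_one_sub {z : ℝ → ℝ} {t : ℝ} (ht : 0 < t) (hz : ∀ᶠ α in atTop, 0 < z α)
    (h : Tendsto (fun α => z α ^ ((α + 2) / 2)) atTop (𝓝 t)) :
    Tendsto (fun α => α * (1 - z α)) atTop (𝓝 (-2 * Real.log t)) := by
  set L : ℝ → ℝ := fun α => Real.log (z α ^ ((α + 2) / 2)) with hL
  have hlog : Tendsto L atTop (𝓝 (Real.log t)) := h.log ht.ne'
  have hzL : ∀ᶠ α in atTop, Real.log (z α) = henonExponent α * L α := by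
    filter_upwards [hz, eventually_ge_atTop 0] with α hα hα0
    rw [hL]
    simp only
    rw [Real.log_rpow hα, henonExponent]
    field_simp
  have hupp : Tendsto (fun α => -(α * henonExponent α * L α)) atTop (𝓝 (-2 * Real.log t)) := by
    have := (tendsto_mul_henonExponent.mul hlog).neg
    rwa [← neg_mul] at this
  have hz1 : Tendsto z atTop (𝓝 1) := by
    have h1 : Tendsto (fun α => Real.exp (henonExponent α * L α)) atTop (𝓝 1) := by
      simpa using (tendsto_henonExponent.mul hlog).rexp
    refine h1.congr' ?_
    filter_upwards [hz, hzL] with α h1 h2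
    rw [← h2, Real.exp_log h1]
  have hlow : Tendsto (fun α => z α * -(α * henonExponent α * L α)) atTop
      (𝓝 (-2 * Real.log t)) := by
    simpa using hz1.mul hupp
  refine tendsto_of_tendsto_of_tendsto_of_le_of_le' hlow hupp ?_ ?_
  · filter_upwards [hz, hzL, eventually_ge_atTop 0] with α h1 h2 h3
    have h4 := Real.one_sub_inv_le_log_of_pos h1
    have h5 := mul_le_mul_of_nonneg_left h4 h1.le
    rw [mul_sub, mul_inv_cancel₀ h1.ne', h2] at h5
    nlinarith [mul_le_mul_of_nonneg_left h5 h3]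
  · filter_upwards [hz, hzL, eventually_ge_atTop 0] with α h1 h2 h3
    have h4 := Real.log_le_sub_one_of_pos h1
    rw [h2] at h4
    nlinarith [mul_le_mul_of_nonneg_left h4 h3]

/-- A planar Lane-Emden solution is a Hénon solution with `N = 2` and `α = 0`. -/
lemma IsLaneEmdenSolution.isRadialHenon {p : ℝ} {m : ℕ} {w : ℝ → ℝ}
    (hw : IsLaneEmdenSolution p m w) : IsRadialHenon 2 0 p w (derivWithin w (Icc 0 1)) := by
  have h : IsDirichletSolution 2 (fun x => ‖x‖ ^ (0 : ℝ)) p (radialFun 2 w) := by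
    simpa only [Real.rpow_zero] using hw.solution
  exact h.isRadialHenon le_rfl

/-- The profile of a planar Lane-Emden solution is a profile in dimension two. -/
lemma IsLaneEmdenSolution.isEmdenProfile {p : ℝ} (hp : 1 < p) {m : ℕ} {w : ℝ → ℝ}
    (hw : IsLaneEmdenSolution p m w) :
    IsEmdenProfile 1 p (profileRadius 0 p (w 0)) (henonProfile 0 p w)
      (henonProfileDeriv 0 p w (derivWithin w (Icc 0 1))) := by
  simpa using hw.isRadialHenon.isEmdenProfile le_rfl le_rfl hp hw.pos_zero

section Asymptotics

variable {N : ℕ} {p : ℝ} {m : ℕ} {u : ℝ → ℝ → ℝ} {w : ℝ → ℝ} {r : ℝ → ℕ → ℝ} {t : ℕ → ℝ}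

/-- All Hénon solutions of the family give profiles, in a dimension tending to two. -/
lemma eventually_isEmdenProfile (hN : 2 ≤ N) (hp : 1 < p)
    (hu : ∀ᶠ α in atTop, IsHenonSolution N α p m (u α)) :
    ∀ᶠ α in atTop, 1 ≤ 1 + ((N : ℝ) - 2) * henonExponent α ∧
      IsEmdenProfile (1 + ((N : ℝ) - 2) * henonExponent α) p (profileRadius α p (u α 0))
        (henonProfile α p (u α))
        (henonProfileDeriv α p (u α) (derivWithin (u α) (Icc 0 1))) := by
  have hN' : (2 : ℝ) ≤ N := by exact_mod_cast hN
  filter_upwards [hu, eventually_ge_atTop 0] with α hα h0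
  exact ⟨by nlinarith [henonExponent_pos h0],
    (hα.solution.isRadialHenon hN).isEmdenProfile hN h0 hp hα.pos_zero⟩

lemma tendsto_profileDimension :
    Tendsto (fun α => 1 + ((N : ℝ) - 2) * henonExponent α) atTop (𝓝 1) := by
  simpa using (tendsto_henonExponent.const_mul ((N : ℝ) - 2)).const_add 1

lemma tendsto_profilePoint (hN : 2 ≤ N) (hp : 1 < p)
    (hu : ∀ᶠ α in atTop, IsHenonSolution N α p m (u α)) (hw : IsLaneEmdenSolution p m w)
    (hr : ∀ᶠ α in atTop, IsZeroEnumeration m (u α) (r α)) (ht : IsZeroEnumeration m w t) {i : ℕ}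
    (hi : 1 ≤ i) (him : i ≤ m) :
    Tendsto (fun α => profilePoint α p (u α 0) (r α i)) atTop (𝓝 (profilePoint 0 p (w 0) (t i))) := by
  refine IsEmdenProfile.tendsto_zeros (ρ := fun α i => profilePoint α p (u α 0) (r α i))
    (ρ₀ := fun i => profilePoint 0 p (w 0) (t i)) hp (hw.isEmdenProfile hp)
    (eventually_isEmdenProfile hN hp hu) tendsto_profileDimension
    (ht.enumeratesZeros le_rfl hw.pos_zero) ?_ hi him
  filter_upwards [hu, hr, eventually_ge_atTop 0] with α h1 h2 h3
  exact h2.enumeratesZeros h3 h1.pos_zero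

lemma tendsto_profileRadius (hN : 2 ≤ N) (hp : 1 < p) (hm : 1 ≤ m)
    (hu : ∀ᶠ α in atTop, IsHenonSolution N α p m (u α)) (hw : IsLaneEmdenSolution p m w)
    (hr : ∀ᶠ α in atTop, IsZeroEnumeration m (u α) (r α)) (ht : IsZeroEnumeration m w t) :
    Tendsto (fun α => profileRadius α p (u α 0)) atTop (𝓝 (profileRadius 0 p (w 0))) := by
  have h := tendsto_profilePoint hN hp hu hw hr ht hm le_rfl
  rw [ht.last, profilePoint_one] at h
  refine h.congr' ?_
  filter_upwards [hr] with α hα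
  rw [hα.last, profilePoint_one]

lemma tendsto_zero_rpow (hN : 2 ≤ N) (hp : 1 < p)
    (hu : ∀ᶠ α in atTop, IsHenonSolution N α p m (u α)) (hw : IsLaneEmdenSolution p m w)
    (hr : ∀ᶠ α in atTop, IsZeroEnumeration m (u α) (r α)) (ht : IsZeroEnumeration m w t) {i : ℕ}
    (hi : 1 ≤ i) (him : i ≤ m) :
    Tendsto (fun α => r α i ^ ((α + 2) / 2)) atTop (𝓝 (t i)) := by
  have ha := profileRadius_pos (p := p) le_rfl hw.pos_zero
  have h := (tendsto_profilePoint hN hp hu hw hr ht hi him).div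
    (tendsto_profileRadius hN hp (hi.trans him) hu hw hr ht) ha.ne'
  have h1 : profilePoint 0 p (w 0) (t i) / profileRadius 0 p (w 0) = t i := by
    rw [profilePoint, mul_div_cancel_left₀ _ ha.ne']; simp
  rw [h1] at h
  refine h.congr' ?_
  filter_upwards [hu, eventually_ge_atTop 0] with α h2 h3
  rw [Pi.div_apply, profilePoint,
    mul_div_cancel_left₀ _ (profileRadius_pos (p := p) h3 h2.pos_zero).ne']

/-- The rescaled central values converge. -/
lemma tendsto_central_value (hN : 2 ≤ N) (hp : 1 < p) (hm : 1 ≤ m)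
    (hu : ∀ᶠ α in atTop, IsHenonSolution N α p m (u α)) (hw : IsLaneEmdenSolution p m w)
    (hr : ∀ᶠ α in atTop, IsZeroEnumeration m (u α) (r α)) (ht : IsZeroEnumeration m w t) :
    Tendsto (fun α => henonExponent α ^ (2 / (p - 1)) * u α 0) atTop (𝓝 (w 0)) := by
  have h := (tendsto_profileRadius hN hp hm hu hw hr ht).rpow_const (p := 2 / (p - 1))
    (Or.inl (profileRadius_pos le_rfl hw.pos_zero).ne')
  have h1 : profileRadius 0 p (w 0) ^ (2 / (p - 1)) = w 0 := by
    rw [← henonExponent_rpow_mul le_rfl hp hw.pos_zero]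
    simp [henonExponent]
  rw [h1] at h
  refine h.congr' ?_
  filter_upwards [hu, eventually_ge_atTop 0] with α h2 h3
  rw [henonExponent_rpow_mul h3 hp h2.pos_zero]

/-- Away from the boundary `x = a r^{(α+2)/2}` tends to `0`, where the profiles take the value
`1`. -/
lemma tendstoUniformlyOn_ball (hN : 2 ≤ N) (hp : 1 < p) (hm : 1 ≤ m)
    (hu : ∀ᶠ α in atTop, IsHenonSolution N α p m (u α)) (hw : IsLaneEmdenSolution p m w)
    (hr : ∀ᶠ α in atTop, IsZeroEnumeration m (u α) (r α)) (ht : IsZeroEnumeration m w t) {R₀ : ℝ}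
    (h0 : 0 < R₀) (h1 : R₀ < 1) :
    TendstoUniformlyOn (fun (α : ℝ) (x : EuclideanSpace ℝ (Fin N)) =>
      (2 / (α + 2)) ^ (2 / (p - 1)) * radialFun N (u α) x) (fun _ => w 0) atTop
      (Metric.ball 0 R₀) := by
  set b : ℝ → ℝ := fun α => henonExponent α ^ (2 / (p - 1)) * u α 0
  have hb : Tendsto b atTop (𝓝 (w 0)) := tendsto_central_value hN hp hm hu hw hr ht
  have hpt : Tendsto (fun α => profilePoint α p (u α 0) R₀) atTop (𝓝 0) := by
    have h2 : Tendsto (fun α : ℝ => R₀ ^ ((α + 2) / 2)) atTop (𝓝 0) :=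
      (tendsto_rpow_atTop_of_base_lt_one R₀ (by linarith) h1).comp
        ((tendsto_atTop_add_const_right _ _ tendsto_id).atTop_div_const two_pos)
    simpa [profilePoint] using (tendsto_profileRadius hN hp hm hu hw hr ht).mul h2
  have herr : Tendsto (fun α => |b α| * profilePoint α p (u α 0) R₀ + |b α - w 0|) atTop (𝓝 0) := by
    simpa using (hb.abs.mul hpt).add (hb.sub_const (w 0)).abs
  rw [Metric.tendstoUniformlyOn_iff]
  intro ε hε
  filter_upwards [hu, eventually_ge_atTop 0, eventually_isEmdenProfile hN hp hu,
    herr.eventually_lt_const hε] with α h2 h3 h4 h5 x hx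
  rw [mem_ball_zero_iff] at hx
  have hx1 : ‖x‖ ∈ Icc (0 : ℝ) 1 := ⟨norm_nonneg x, by linarith⟩
  have hmem := profilePoint_mem_Icc (p := p) h3 h2.pos_zero hx1
  have h6 := h4.2.abs_sub_one_le h4.1 hp hmem
  have h7 := (profilePoint_strictMonoOn (p := p) h3 h2.pos_zero).monotoneOn
    (norm_nonneg x) h0.le hx.le
  rw [dist_comm, Real.dist_eq, radialFun, henonProfile_profilePoint (p := p) h3 h2.pos_zero hx1.1,
    ← mul_assoc]
  set P := henonProfile α p (u α) (profilePoint α p (u α 0) ‖x‖)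
  have h8 : (2 / (α + 2)) ^ (2 / (p - 1)) * u α 0 * P - w 0 = b α * (P - 1) + (b α - w 0) := by
    simp only [b, henonExponent]; ring
  rw [h8]
  refine (abs_add_le _ _).trans_lt (lt_of_le_of_lt ?_ h5)
  rw [abs_mul]
  gcongr
  exact h6.trans h7

/-- Every solution attains its maximum modulus at the origin. -/
lemma IsHenonSolution.abs_le (hN : 2 ≤ N) (hp : 1 < p) {α : ℝ} (hα : 0 ≤ α) {U : ℝ → ℝ}
    (hU : IsHenonSolution N α p m U) {s : ℝ} (hs : s ∈ Icc 0 1) : |U s| ≤ U 0 := by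
  have hN' : (2 : ℝ) ≤ N := by exact_mod_cast hN
  have h := ((hU.solution.isRadialHenon hN).isEmdenProfile hN hα hp hU.pos_zero).abs_le_one
    (by nlinarith [henonExponent_pos hα]) hp (profilePoint_mem_Icc (p := p) hα hU.pos_zero hs)
  rw [henonProfile_profilePoint (p := p) hα hU.pos_zero hs.1, abs_mul, abs_of_pos hU.pos_zero]
  exact mul_le_of_le_one_right hU.pos_zero.le h

lemma IsExtremalValues.le (hN : 2 ≤ N) (hp : 1 < p) {α : ℝ} (hα : 0 ≤ α) {U : ℝ → ℝ}
    (hU : IsHenonSolution N α p m U) {z M : ℕ → ℝ} (hz : IsZeroEnumeration m U z)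
    (hM : IsExtremalValues m U z M) {i : ℕ} (hi : 1 ≤ i) (him : i ≤ m) : M i ≤ U 0 := by
  obtain rfl | ⟨n, hn, rfl⟩ : i = 1 ∨ ∃ n, 1 ≤ n ∧ i = n + 1 := by
    rcases hi.eq_or_lt with h | h
    · exact Or.inl h.symm
    · exact Or.inr ⟨i - 1, by omega, by omega⟩
  · obtain ⟨s, hs, hs'⟩ := hM.first.1
    rw [← hs']
    exact (le_abs_self _).trans (hU.abs_le hN hp hα
      ⟨hs.1, hs.2.trans (hz.mem ⟨le_rfl, him⟩).1.2⟩)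
  · obtain ⟨s, hs, hs'⟩ := (hM.succ n hn him).1
    rw [← hs']
    exact hU.abs_le hN hp hα ⟨(hz.mem ⟨hn, by omega⟩).1.1.le.trans hs.1,
      hs.2.trans (hz.mem ⟨by omega, him⟩).1.2⟩

/-- Each extremal value is bounded below by a fixed fraction of the central value: between two
consecutive zeros of the limit profile there is a point at which that profile does not vanish. -/
lemma exists_eventually_le_extremalValue (hN : 2 ≤ N) (hp : 1 < p)
    (hu : ∀ᶠ α in atTop, IsHenonSolution N α p m (u α)) (hw : IsLaneEmdenSolution p m w)
    (hr : ∀ᶠ α in atTop, IsZeroEnumeration m (u α) (r α)) (ht : IsZeroEnumeration m w t)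
    {M : ℝ → ℕ → ℝ} (hM : ∀ᶠ α in atTop, IsExtremalValues m (u α) (r α) (M α)) {i : ℕ}
    (hi : 1 ≤ i) (him : i ≤ m) : ∃ c > 0, ∀ᶠ α in atTop, c * u α 0 ≤ M α i := by
  obtain rfl | ⟨n, hn, rfl⟩ : i = 1 ∨ ∃ n, 1 ≤ n ∧ i = n + 1 := by
    rcases hi.eq_or_lt with h | h
    · exact Or.inl h.symm
    · exact Or.inr ⟨i - 1, by omega, by omega⟩
  · refine ⟨1, one_pos, ?_⟩
    filter_upwards [hr, hM] with α h1 h2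
    rw [one_mul]
    exact h2.first.2 ⟨0, ⟨le_rfl, (h1.mem ⟨le_rfl, him⟩).1.1.le⟩, rfl⟩
  · have hn' : n ∈ Icc 1 m := ⟨hn, by omega⟩
    have hn1 : n + 1 ∈ Icc 1 m := ⟨by omega, him⟩
    have hprof := hw.isEmdenProfile hp
    have hZ := ht.enumeratesZeros (p := p) le_rfl hw.pos_zero
    obtain ⟨q, hq1, hq2⟩ := exists_between (hZ.strictMonoOn hn' hn1 (Nat.lt_succ_self n))
    have hφq : 0 < |henonProfile 0 p w q| := abs_pos.2 (hZ.ne_zero_between hn him ⟨hq1, hq2⟩)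
    refine ⟨|henonProfile 0 p w q| / 2, half_pos hφq, ?_⟩
    filter_upwards [hu, hr, hM, eventually_ge_atTop 0,
      (tendsto_profilePoint hN hp hu hw hr ht hn hn'.2).eventually_lt_const hq1,
      (tendsto_profilePoint hN hp hu hw hr ht hn1.1 him).eventually_const_lt hq2,
      hprof.eventually_close hp (eventually_isEmdenProfile hN hp hu) tendsto_profileDimension
        (half_pos hφq)] with α h1 h2 h3 h4 h5 h6 hclose
    have hr1 := (h2.mem hn').1
    have hr2 := (h2.mem hn1).1
    have hq0 : 0 ≤ q := (hZ.mem hn').1.1.le.trans hq1.le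
    have hqa : q ≤ profileRadius α p (u α 0) :=
      h6.le.trans (profilePoint_mem_Icc h4 h1.pos_zero ⟨hr2.1.le, hr2.2⟩).2
    obtain ⟨s, hs, rfl⟩ := exists_profilePoint_eq h4 h1.pos_zero ⟨hq0, hqa⟩
    have hmono := profilePoint_strictMonoOn (p := p) h4 h1.pos_zero
    have hs1 : r α n ≤ s := ((hmono.lt_iff_lt hr1.1.le hs.1).1 h5).le
    have hs2 : s ≤ r α (n + 1) := ((hmono.lt_iff_lt hs.1 hr2.1.le).1 h6).le
    refine le_trans ?_ ((h3.succ n hn him).2 ⟨s, ⟨hs1, hs2⟩, rfl⟩)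
    have h7 := (hclose _ hq0 hqa (hq2.le.trans (hZ.mem hn1).1.2)).1
    simp only
    rw [henonProfile_profilePoint (p := p) h4 h1.pos_zero hs.1, abs_mul, abs_of_pos h1.pos_zero,
      mul_comm]
    refine mul_le_mul_of_nonneg_left ?_ h1.pos_zero.le
    have h8 := abs_sub_abs_le_abs_sub (henonProfile 0 p w (profilePoint α p (u α 0) s))
      (henonProfile α p (u α) (profilePoint α p (u α 0) s))
    rw [abs_sub_comm] at h8
    linarith

/-- All extremal values are comparable with `((α + 2) / 2)^{2/(p-1)}`. -/
lemma exists_eventually_extremalValue_bounds (hN : 2 ≤ N) (hp : 1 < p) (hm : 1 ≤ m)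
    (hu : ∀ᶠ α in atTop, IsHenonSolution N α p m (u α)) (hw : IsLaneEmdenSolution p m w)
    (hr : ∀ᶠ α in atTop, IsZeroEnumeration m (u α) (r α)) (ht : IsZeroEnumeration m w t)
    {M : ℝ → ℕ → ℝ} (hM : ∀ᶠ α in atTop, IsExtremalValues m (u α) (r α) (M α)) :
    ∃ C₁ C₂ : ℝ, 0 < C₁ ∧ 0 < C₂ ∧ ∀ᶠ α in atTop, ∀ i : ℕ, 1 ≤ i → i ≤ m →
      C₁ * ((α + 2) / 2) ^ (2 / (p - 1)) ≤ M α i ∧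
      M α i ≤ C₂ * ((α + 2) / 2) ^ (2 / (p - 1)) := by
  have hex : ∀ i : ℕ, ∃ c > 0, i ∈ Finset.Icc 1 m → ∀ᶠ α in atTop, c * u α 0 ≤ M α i := by
    intro i
    by_cases hi : i ∈ Finset.Icc 1 m
    · obtain ⟨c, hc, hc'⟩ := exists_eventually_le_extremalValue hN hp hu hw hr ht hM
        (Finset.mem_Icc.1 hi).1 (Finset.mem_Icc.1 hi).2
      exact ⟨c, hc, fun _ => hc'⟩
    · exact ⟨1, one_pos, fun h => absurd h hi⟩
  choose c hc hcM using hex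
  have hne : (Finset.Icc 1 m).Nonempty := ⟨1, Finset.mem_Icc.2 ⟨le_rfl, hm⟩⟩
  set C := (Finset.Icc 1 m).inf' hne c
  have hC : 0 < C := (Finset.lt_inf'_iff hne).2 fun i _ => hc i
  have hw0 := hw.pos_zero
  refine ⟨C * (w 0 / 2), 2 * w 0, by positivity, by positivity, ?_⟩
  have hall := (Filter.eventually_all_finset (Finset.Icc 1 m)).2 hcM
  have hb := tendsto_central_value hN hp hm hu hw hr ht
  filter_upwards [hu, hr, hM, eventually_ge_atTop 0, hall,
    hb.eventually_const_lt (half_lt_self hw0), hb.eventually_lt_const (by linarith : w 0 < 2 * w 0)]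
    with α h1 h2 h3 h4 h5 h6 h7 i hi him
  set Λ := ((α + 2) / 2) ^ (2 / (p - 1)) with hΛ
  have hΛ0 : 0 < Λ := Real.rpow_pos_of_pos (by positivity) _
  have hθΛ : henonExponent α ^ (2 / (p - 1)) * Λ = 1 := by
    rw [hΛ, ← Real.mul_rpow (henonExponent_pos h4).le (by positivity), henonExponent,
      show 2 / (α + 2) * ((α + 2) / 2) = 1 by field_simp, Real.one_rpow]
  have hu0 : u α 0 = henonExponent α ^ (2 / (p - 1)) * u α 0 * Λ := by
    linear_combination -(u α 0) * hθΛ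
  have hmem := Finset.mem_Icc.2 ⟨hi, him⟩
  constructor
  · refine le_trans ?_ (h5 i hmem)
    have h8 : C ≤ c i := Finset.inf'_le c hmem
    have h9 : w 0 / 2 * Λ ≤ u α 0 := by
      rw [hu0]; exact mul_le_mul_of_nonneg_right h6.le hΛ0.le
    rw [mul_assoc]
    exact mul_le_mul h8 h9 (by positivity) (hc i).le
  · refine (h3.le hN hp h4 h1 h2 hi him).trans ?_
    rw [hu0]
    exact mul_le_mul_of_nonneg_right h7.le hΛ0.le

end Asymptotics

theorem theorem1p4 (N : ℕ) (hN : 3 ≤ N) (p : ℝ) (hp : 1 < p) (m : ℕ) (hm : 1 ≤ m)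
    (u : ℝ → ℝ → ℝ)
    (hu : ∀ α : ℝ, alphaThreshold N p < α → IsHenonSolution N α p m (u α))
    (w : ℝ → ℝ) (hw : IsLaneEmdenSolution p m w) :
    ∃ (r : ℝ → ℕ → ℝ) (t : ℕ → ℝ) (M : ℝ → ℕ → ℝ),
      (∀ α : ℝ, alphaThreshold N p < α →
        IsZeroEnumeration m (u α) (r α) ∧ IsExtremalValues m (u α) (r α) (M α)) ∧
      IsZeroEnumeration m w t ∧
      (∀ i : ℕ, 1 ≤ i → i ≤ m →
        Tendsto (fun α : ℝ => α * (1 - r α i)) atTop (𝓝 (-2 * Real.log (t i)))) ∧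
      (∀ R₀ : ℝ, 0 < R₀ → R₀ < 1 →
        TendstoUniformlyOn
          (fun (α : ℝ) (x : EuclideanSpace ℝ (Fin N)) =>
            (2 / (α + 2)) ^ (2 / (p - 1)) * radialFun N (u α) x)
          (fun _ => w 0) atTop (Metric.ball 0 R₀)) ∧
      (∃ α₀ : ℝ, alphaThreshold N p < α₀ ∧ ∃ C₁ C₂ : ℝ, 0 < C₁ ∧ 0 < C₂ ∧
        ∀ α : ℝ, α₀ ≤ α → ∀ i : ℕ, 1 ≤ i → i ≤ m →
          C₁ * ((α + 2) / 2) ^ (2 / (p - 1)) ≤ M α i ∧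
          M α i ≤ C₂ * ((α + 2) / 2) ^ (2 / (p - 1))) := by
  have hN2 : 2 ≤ N := by omega
  have hα0 : ∀ α, alphaThreshold N p < α → 0 ≤ α := fun α hα =>
    (le_max_left 0 ((p * ((N : ℝ) - 2) - ((N : ℝ) + 2)) / 2)).trans hα.le
  have hex : ∀ α, ∃ (z M : ℕ → ℝ), alphaThreshold N p < α →
      IsZeroEnumeration m (u α) z ∧ IsExtremalValues m (u α) z M := by
    intro α
    by_cases hα : alphaThreshold N p < α
    · have hrad := (hu α hα).solution.isRadialHenon hN2
      obtain ⟨z, hz⟩ := exists_isZeroEnumeration hN2 (hα0 α hα) hp hm hrad (hu α hα).pos_zero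
        (hu α hα).nodal
      obtain ⟨M, hM⟩ := exists_isExtremalValues hm hrad.continuousOn hz
      exact ⟨z, M, fun _ => ⟨hz, hM⟩⟩
    · exact ⟨0, 0, fun h => absurd h hα⟩
  choose r M hrM using hex
  obtain ⟨t, ht⟩ := exists_isZeroEnumeration le_rfl le_rfl hp hm hw.isRadialHenon hw.pos_zero
    hw.nodal
  have hthr := eventually_gt_atTop (alphaThreshold N p)
  have hu' : ∀ᶠ α in atTop, IsHenonSolution N α p m (u α) := hthr.mono hu
  have hr : ∀ᶠ α in atTop, IsZeroEnumeration m (u α) (r α) := hthr.mono fun α hα => (hrM α hα).1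
  have hM : ∀ᶠ α in atTop, IsExtremalValues m (u α) (r α) (M α) :=
    hthr.mono fun α hα => (hrM α hα).2
  refine ⟨r, t, M, hrM, ht, fun i hi him => ?_, fun R₀ h0 h1 => ?_, ?_⟩
  · refine tendsto_mul_one_sub (ht.mem ⟨hi, him⟩).1.1 ?_ (tendsto_zero_rpow hN2 hp hu' hw hr ht hi him)
    exact hr.mono fun α hα => (hα.mem ⟨hi, him⟩).1.1
  · exact tendstoUniformlyOn_ball hN2 hp hm hu' hw hr ht h0 h1
  · obtain ⟨C₁, C₂, hC₁, hC₂, hev⟩ :=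
      exists_eventually_extremalValue_bounds hN2 hp hm hu' hw hr ht hM
    obtain ⟨α₀, hα₀⟩ := eventually_atTop.1 hev
    exact ⟨max α₀ (alphaThreshold N p + 1), lt_max_of_lt_right (by linarith), C₁, C₂, hC₁, hC₂,
      fun α hα => hα₀ α ((le_max_left _ _).trans hα)⟩
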